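/- Let $\mathcal C$ be a semi-abelian category (pointed, Barr exact, protomodular, with finite coproducts) satisfying the condition "Huq $\Rightarrow$ Smith": two equivalence relations on the same object commute in the sense of Smith whenever their normalizations commute in the sense of Huq. Let $\mathrm{Grpd}(\mathcal C)$ be the 2-category of internal groupoids, internal functors and internal natural transformations in $\mathcal C$. For a groupoid, $d$ and $c$ denote the domain and codomain, $e$ the identities, $m$ the composition and $i$ the inversion; composites are written in diagrammatic order. An internal crossed module in $\mathcal C$ is a morphism $\partial\colon G\to G_0$ with an internal action $\xi\colon G_0\flat G\to G$ (an algebra for the monad $G_0\flat(-)$) such that $(\partial\flat 1)\cdot\xi=\chi_G$ and $\xi\cdot\partial=(1\flat\partial)\cdot\chi_{G_0}$, where $\chi$ denotes the conjugation actions. A morphism $P=(p,p_0)$ consists of a pair of morphisms commuting with $\partial$ and with the actions. For every crossed module the semi-direct product $G_1=G\rtimes_\xi G_0$ (the coequalizer of $G_0\flat G\to G_0+G$ and $G_0\flat G\xrightarrow{\xi} G\to G_0+G$) exists. Let $g\colon G\to G_1$ and $e\colon G_0\to G_1$ be the canonical morphisms. Then the reflexive graph on $G_1$ and $G_0$ with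 $c$ given by $g\cdot c=0$, $e\cdot c=1$ and $d$ given by $g\cdot d=\partial$, $e\cdot d=1$ has a unique structure of internal groupoid. Hence there is a 2-category $\mathrm{XMod}(\mathcal C)$ of internal crossed modules and their morphisms, in which a 2-cell $P\Rightarrow Q\colon \mathbb H\to\mathbb G$ is an arrow $\alpha\colon H_0\to G_1=G\rtimes_\xi G_0$ with $$\alpha\cdot d=p_0,\qquad \alpha\cdot c=q_0,\qquad p\cdot g=\langle\partial\cdot\alpha,\;q\cdot g\rangle\cdot m,$$ with the compositions inherited from internal natural transformations. The normalization functor $J\colon\mathrm{Grpd}(\mathcal C)\to\mathrm{XMod}(\mathcal C)$, which sends a groupoid $\mathbb G$ to $\ker c\to G_1\xrightarrow{d}G_0$ with the action of $G_0$ obtained by restricting $[e,\ker c]\colon G_0+\ker c\to G_1$, is an equivalence of categories. It extends to a biequivalence of 2-categories, whose effect on natural transformations is obtained by identifying $G_1$ with $\ker c\rtimes G_0$ through the canonical isomorphism. Moreover, for every crossed module, $g$ and $g^\bullet=g\cdot i$ have a unique cooperator $m_0\colon G\times G\to G_1$ (that is, $\langle 1,0\rangle\cdot m_0=g$ and $\langle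 0,1\rangle\cdot m_0=g^\bullet$), and an arrow $\alpha\colon H_0\to G_1$ with $\alpha\cdot d=p_0$ and $\alpha\cdot c=q_0$ is a 2-cell $P\Rightarrow Q$ if and only if $\partial\cdot\alpha=\langle p,q\rangle\cdot m_0$. -/

import Mathlib

open CategoryTheory CategoryTheory.Limits

universe v u

attribute [local simp] pullback.lift_fst pullback.lift_snd pullback.lift_fst_assoc
  pullback.lift_snd_assoc coprod.inl_desc coprod.inr_desc coprod.inl_desc_assoc
  coprod.inr_desc_assoc

/-! ## Semi-abelian categories and the condition "Huq implies Smith" -/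

/-- A semi-abelian category: pointed, with finite coproducts, regular, such that internal equivalence
relations are kernel pairs (so Barr exact), and protomodular, which for pointed categories with
finite limits is the split short five lemma. -/
class SemiAbelian (C : Type u) [Category.{v} C] [HasZeroMorphisms C] : Prop extends
    Regular C where
  hasZeroObject : HasZeroObject C
  hasFiniteCoproducts : HasFiniteCoproducts C
  effective {R A : C} (r₁ r₂ : R ⟶ A) (_ : IsEquivalenceRelation r₁ r₂) :
    ∃ (B : C) (q : A ⟶ B), IsKernelPair q r₁ r₂
  splitShortFive {A B A' B' : C} (p : A ⟶ B) (s : B ⟶ A) (_ : s ≫ p = 𝟙 B)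
    (p' : A' ⟶ B') (s' : B' ⟶ A') (_ : s' ≫ p' = 𝟙 B')
    (f : A ⟶ A') (g : B ⟶ B') (hp : p ≫ g = f ≫ p') (_ : s ≫ f = g ≫ s')
    (_ : IsIso g) (_ : IsIso (kernel.map p p' f g hp)) : IsIso f

attribute [instance] SemiAbelian.hasZeroObject SemiAbelian.hasFiniteCoproducts

/-- `φ` is a cooperator of `f` and `g`. -/
def IsCooperator {C : Type u} [Category.{v} C] [HasZeroMorphisms C] [HasFiniteLimits C]
    {X Y E : C} (f : X ⟶ E) (g : Y ⟶ E) (φ : X ⨯ Y ⟶ E) : Prop :=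
  prod.lift (𝟙 X) (0 : X ⟶ Y) ≫ φ = f ∧ prod.lift (0 : Y ⟶ X) (𝟙 Y) ≫ φ = g

/-- `f` and `g` commute in the sense of Huq. -/
def HuqCommute {C : Type u} [Category.{v} C] [HasZeroMorphisms C] [HasFiniteLimits C]
    {X Y E : C} (f : X ⟶ E) (g : Y ⟶ E) : Prop :=
  ∃ φ : X ⨯ Y ⟶ E, IsCooperator f g φ

/-- The equivalence relations `(r₁, r₂)` and `(s₁, s₂)` on `E` commute in the sense of Smith: there is
a connector `Φ`, in elements a partial operation `Φ (x, y, z)`, defined for `x R y S z`, with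
`Φ (x, y, y) = x` and `Φ (y, y, z) = z`. -/
def SmithCommute {C : Type u} [Category.{v} C] [HasFiniteLimits C]
    {R S E : C} {r₁ r₂ : R ⟶ E} {s₁ s₂ : S ⟶ E}
    (hR : EquivalenceRelation r₁ r₂) (hS : EquivalenceRelation s₁ s₂) : Prop :=
  ∃ Φ : pullback r₂ s₁ ⟶ E,
    pullback.lift (𝟙 R) (r₂ ≫ hS.r) (by simp) ≫ Φ = r₁ ∧
    pullback.lift (s₁ ≫ hR.r) (𝟙 S) (by simp) ≫ Φ = s₂

/-- Two equivalence relations commute in the sense of Smith as soon as their normalizations commute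
in the sense of Huq. -/
class HuqImpliesSmith (C : Type u) [Category.{v} C] [HasZeroMorphisms C] [HasFiniteLimits C] :
    Prop where
  smithCommute {R S E : C} {r₁ r₂ : R ⟶ E} {s₁ s₂ : S ⟶ E}
    (hR : EquivalenceRelation r₁ r₂) (hS : EquivalenceRelation s₁ s₂) :
    HuqCommute (kernel.ι r₂ ≫ r₁) (kernel.ι s₂ ≫ s₁) → SmithCommute hR hS

/-! ## Internal groupoids -/

/-- An internal reflexive graph: `d` is the domain, `c` the codomain, `e` gives the identities. -/
structure ReflGraph (C : Type u) [Category.{v} C] where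
  G₀ : C
  G₁ : C
  d : G₁ ⟶ G₀
  c : G₁ ⟶ G₀
  e : G₀ ⟶ G₁
  e_d : e ≫ d = 𝟙 G₀
  e_c : e ≫ c = 𝟙 G₀

/-- An internal groupoid structure on a reflexive graph. A pair in `pullback c d` is a pair of
composable arrows, written in diagrammatic order. -/
structure GroupoidStructure {C : Type u} [Category.{v} C] [HasFiniteLimits C]
    (Γ : ReflGraph C) where
  m : pullback Γ.c Γ.d ⟶ Γ.G₁
  m_d : m ≫ Γ.d = pullback.fst Γ.c Γ.d ≫ Γ.d
  m_c : m ≫ Γ.c = pullback.snd Γ.c Γ.d ≫ Γ.c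
  e_m : pullback.lift (Γ.d ≫ Γ.e) (𝟙 Γ.G₁) (by simp [Γ.e_c]) ≫ m = 𝟙 Γ.G₁
  m_e : pullback.lift (𝟙 Γ.G₁) (Γ.c ≫ Γ.e) (by simp [Γ.e_d]) ≫ m = 𝟙 Γ.G₁
  assoc {T : C} (x y z : T ⟶ Γ.G₁) (hxy : x ≫ Γ.c = y ≫ Γ.d) (hyz : y ≫ Γ.c = z ≫ Γ.d) :
    pullback.lift (pullback.lift x y hxy ≫ m) z (by simp [m_c, hyz]) ≫ m =
      pullback.lift x (pullback.lift y z hyz ≫ m) (by simp [m_d, hxy]) ≫ m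
  i : Γ.G₁ ⟶ Γ.G₁
  i_d : i ≫ Γ.d = Γ.c
  i_c : i ≫ Γ.c = Γ.d
  m_i : pullback.lift (𝟙 Γ.G₁) i (by simp [i_d]) ≫ m = Γ.d ≫ Γ.e
  i_m : pullback.lift i (𝟙 Γ.G₁) (by simp [i_c]) ≫ m = Γ.c ≫ Γ.e

/-- An internal groupoid. -/
structure IntGroupoid (C : Type u) [Category.{v} C] [HasFiniteLimits C] extends ReflGraph C where
  str : GroupoidStructure toReflGraph

namespace IntGroupoid

variable {C : Type u} [Category.{v} C] [HasFiniteLimits C]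

/-- Composition of generalized arrows `x : T ⟶ G₁` and `y : T ⟶ G₁`. -/
noncomputable def cmp (G : IntGroupoid C) {T : C} (x y : T ⟶ G.G₁) (h : x ≫ G.c = y ≫ G.d) :
    T ⟶ G.G₁ :=
  pullback.lift x y h ≫ G.str.m

section
variable (G : IntGroupoid C) {T : C}

theorem cmp_d (x y : T ⟶ G.G₁) (h : x ≫ G.c = y ≫ G.d) : G.cmp x y h ≫ G.d = x ≫ G.d := by
  simp [cmp, G.str.m_d]

theorem cmp_c (x y : T ⟶ G.G₁) (h : x ≫ G.c = y ≫ G.d) : G.cmp x y h ≫ G.c = y ≫ G.c := by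
  simp [cmp, G.str.m_c]

theorem cmp_assoc (x y z : T ⟶ G.G₁) (hxy : x ≫ G.c = y ≫ G.d) (hyz : y ≫ G.c = z ≫ G.d) :
    G.cmp (G.cmp x y hxy) z ((G.cmp_c x y hxy).trans hyz) =
      G.cmp x (G.cmp y z hyz) (hxy.trans (G.cmp_d y z hyz).symm) :=
  G.str.assoc x y z hxy hyz

theorem comp_cmp {S : C} (t : S ⟶ T) (x y : T ⟶ G.G₁) (h : x ≫ G.c = y ≫ G.d) :
    t ≫ G.cmp x y h = G.cmp (t ≫ x) (t ≫ y) (by simp [h]) := by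
  simp only [cmp, ← Category.assoc]
  congr 1
  ext <;> simp

theorem e_cmp (a : T ⟶ G.G₀) (x : T ⟶ G.G₁) (h : (a ≫ G.e) ≫ G.c = x ≫ G.d) :
    G.cmp (a ≫ G.e) x h = x := by
  have ha : a = x ≫ G.d := by simpa [G.e_c] using h
  subst ha
  have := G.comp_cmp x (G.d ≫ G.e) (𝟙 _) (by simp [G.e_c])
  rw [cmp, G.str.e_m] at this
  simpa using this.symm

theorem cmp_e (x : T ⟶ G.G₁) (a : T ⟶ G.G₀) (h : x ≫ G.c = (a ≫ G.e) ≫ G.d) :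
    G.cmp x (a ≫ G.e) h = x := by
  have ha : x ≫ G.c = a := by simpa [G.e_d] using h
  subst ha
  have := G.comp_cmp x (𝟙 _) (G.c ≫ G.e) (by simp [G.e_d])
  rw [cmp, G.str.m_e] at this
  simpa using this.symm

theorem e_d_assoc {S : C} (t : G.G₀ ⟶ S) : G.e ≫ G.d ≫ t = t := by simp [reassoc_of% G.e_d]

theorem e_c_assoc {S : C} (t : G.G₀ ⟶ S) : G.e ≫ G.c ≫ t = t := by simp [reassoc_of% G.e_c]

theorem unit_cmp (w x : T ⟶ G.G₁) (h : w ≫ G.c = x ≫ G.d) (hw : w = w ≫ G.d ≫ G.e) :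
    G.cmp w x h = x := by
  rw [← Category.assoc] at hw
  have := G.e_cmp (w ≫ G.d) x (by rw [← hw, h])
  simpa only [← hw] using this

theorem cmp_unit (x w : T ⟶ G.G₁) (h : x ≫ G.c = w ≫ G.d) (hw : w = w ≫ G.d ≫ G.e) :
    G.cmp x w h = x := by
  rw [← Category.assoc] at hw
  have := G.cmp_e x (w ≫ G.d) (by rw [← hw, h])
  simpa only [← hw] using this

theorem cmp_congr {x x' y y' : T ⟶ G.G₁} (h : x ≫ G.c = y ≫ G.d) (hx : x = x') (hy : y = y') :
    G.cmp x y h = G.cmp x' y' (by rw [← hx, ← hy, h]) := by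
  subst hx hy; rfl

end

/-- An internal functor. -/
@[ext]
structure Hom (G H : IntGroupoid C) where
  f₀ : G.G₀ ⟶ H.G₀
  f₁ : G.G₁ ⟶ H.G₁
  f₁_d : f₁ ≫ H.d = G.d ≫ f₀
  f₁_c : f₁ ≫ H.c = G.c ≫ f₀
  e_f₁ : G.e ≫ f₁ = f₀ ≫ H.e
  m_f₁ : G.str.m ≫ f₁ =
    pullback.lift (pullback.fst G.c G.d ≫ f₁) (pullback.snd G.c G.d ≫ f₁)
      (by simp [f₁_d, f₁_c, pullback.condition_assoc]) ≫ H.str.m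

theorem Hom.cmp_f₁ {G H : IntGroupoid C} (P : Hom G H) {T : C} (x y : T ⟶ G.G₁)
    (h : x ≫ G.c = y ≫ G.d) :
    G.cmp x y h ≫ P.f₁ =
      H.cmp (x ≫ P.f₁) (y ≫ P.f₁) (by simp [P.f₁_c, P.f₁_d, reassoc_of% h]) := by
  rw [cmp, Category.assoc, P.m_f₁, ← Category.assoc, cmp]
  congr 1
  ext <;> simp

theorem Hom.e_f₁_assoc {G H : IntGroupoid C} (P : Hom G H) {T : C} (t : H.G₁ ⟶ T) :
    G.e ≫ P.f₁ ≫ t = P.f₀ ≫ H.e ≫ t := by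
  simp [reassoc_of% P.e_f₁]

/-- An internal natural transformation between parallel internal functors. -/
@[ext]
structure Hom₂ {G H : IntGroupoid C} (P Q : Hom G H) where
  app : G.G₀ ⟶ H.G₁
  app_d : app ≫ H.d = P.f₀
  app_c : app ≫ H.c = Q.f₀
  naturality :
    H.cmp P.f₁ (G.c ≫ app) (by simp [P.f₁_c, app_d]) =
      H.cmp (G.d ≫ app) Q.f₁ (by simp [Q.f₁_d, app_c])

theorem Hom₂.nat {G H : IntGroupoid C} {P Q : Hom G H} (α : Hom₂ P Q) {T : C} (x : T ⟶ G.G₁) :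
    H.cmp (x ≫ P.f₁) (x ≫ G.c ≫ α.app) (by simp [P.f₁_c, α.app_d]) =
      H.cmp (x ≫ G.d ≫ α.app) (x ≫ Q.f₁) (by simp [Q.f₁_d, α.app_c]) := by
  rw [← comp_cmp _ x P.f₁ (G.c ≫ α.app) (by simp [P.f₁_c, α.app_d]), α.naturality, comp_cmp]

/-- The identity internal functor. -/
def Hom.id (G : IntGroupoid C) : Hom G G where
  f₀ := 𝟙 _
  f₁ := 𝟙 _
  f₁_d := by simp
  f₁_c := by simp
  e_f₁ := by simp
  m_f₁ := by
    have : pullback.lift (pullback.fst G.c G.d ≫ 𝟙 _) (pullback.snd G.c G.d ≫ 𝟙 _)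
      (by simp [pullback.condition]) = 𝟙 _ := by ext <;> simp
    rw [this]; simp

/-- Composition of internal functors, in diagrammatic order. -/
def Hom.comp {G H K : IntGroupoid C} (P : Hom G H) (Q : Hom H K) : Hom G K where
  f₀ := P.f₀ ≫ Q.f₀
  f₁ := P.f₁ ≫ Q.f₁
  f₁_d := by simp [Q.f₁_d, reassoc_of% P.f₁_d]
  f₁_c := by simp [Q.f₁_c, reassoc_of% P.f₁_c]
  e_f₁ := by simp [Q.e_f₁, reassoc_of% P.e_f₁]
  m_f₁ := by
    rw [reassoc_of% P.m_f₁]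
    have := Q.cmp_f₁ (pullback.fst G.c G.d ≫ P.f₁) (pullback.snd G.c G.d ≫ P.f₁)
      (by simp [P.f₁_d, P.f₁_c, pullback.condition_assoc])
    simpa only [cmp, Category.assoc] using this

instance : CategoryStruct (IntGroupoid C) where
  Hom := Hom
  id := Hom.id
  comp := Hom.comp

section
variable {G H K : IntGroupoid C}
@[simp] theorem id_f₀ : Hom.f₀ (𝟙 G) = 𝟙 _ := rfl
@[simp] theorem id_f₁ : Hom.f₁ (𝟙 G) = 𝟙 _ := rfl
@[simp] theorem comp_f₀ (P : G ⟶ H) (Q : H ⟶ K) : Hom.f₀ (P ≫ Q) = P.f₀ ≫ Q.f₀ := rfl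
@[simp] theorem comp_f₁ (P : G ⟶ H) (Q : H ⟶ K) : Hom.f₁ (P ≫ Q) = P.f₁ ≫ Q.f₁ := rfl
end

/-- The identity natural transformation; more generally, the one given by an equality. -/
def Hom₂.ofEq {G H : IntGroupoid C} {P Q : Hom G H} (h : P = Q) : Hom₂ P Q where
  app := P.f₀ ≫ H.e
  app_d := by simp [H.e_d]
  app_c := by simp [H.e_c, h]
  naturality := by
    subst h
    have h₁ := H.cmp_e P.f₁ (G.c ≫ P.f₀) (by simp [H.e_d, P.f₁_c])
    have h₂ := H.e_cmp (G.d ≫ P.f₀) P.f₁ (by simp [H.e_c, P.f₁_d])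
    simp only [Category.assoc] at h₁ h₂
    rw [h₁, h₂]

/-- Vertical composition of natural transformations. -/
noncomputable def Hom₂.comp {G H : IntGroupoid C} {P Q R : Hom G H} (α : Hom₂ P Q)
    (β : Hom₂ Q R) : Hom₂ P R where
  app := H.cmp α.app β.app (by rw [α.app_c, β.app_d])
  app_d := by rw [cmp_d, α.app_d]
  app_c := by rw [cmp_c, β.app_c]
  naturality := by
    have hα := α.nat (𝟙 G.G₁)
    have hβ := β.nat (𝟙 G.G₁)
    simp only [Category.id_comp] at hα hβ
    have e₁ := H.cmp_assoc P.f₁ (G.c ≫ α.app) (G.c ≫ β.app) (by simp [P.f₁_c, α.app_d])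
      (by simp [α.app_c, β.app_d])
    have e₂ := H.cmp_assoc (G.d ≫ α.app) Q.f₁ (G.c ≫ β.app) (by simp [Q.f₁_d, α.app_c])
      (by simp [Q.f₁_c, β.app_d])
    have e₃ := H.cmp_assoc (G.d ≫ α.app) (G.d ≫ β.app) R.f₁ (by simp [α.app_c, β.app_d])
      (by simp [R.f₁_d, β.app_c])
    simp only [comp_cmp]
    rw [← e₁, H.cmp_congr _ hα rfl, e₂, H.cmp_congr _ rfl hβ, ← e₃]

noncomputable instance (G H : IntGroupoid C) : Category (G ⟶ H) where
  Hom P Q := Hom₂ P Q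
  id _ := Hom₂.ofEq rfl
  comp := Hom₂.comp
  id_comp _ := Hom₂.ext (H.e_cmp _ _ _)
  comp_id _ := Hom₂.ext (H.cmp_e _ _ _)
  assoc _ _ _ := Hom₂.ext (H.cmp_assoc _ _ _ _ _)

section
variable {G H K : IntGroupoid C}

@[simp] theorem id_app (P : G ⟶ H) : Hom₂.app (𝟙 P) = P.f₀ ≫ H.e := rfl

@[simp] theorem comp_app {P Q R : G ⟶ H} (α : P ⟶ Q) (β : Q ⟶ R) :
    Hom₂.app (α ≫ β) = H.cmp α.app β.app (by rw [α.app_c, β.app_d]) := rfl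

theorem eqToHom_app {P Q : G ⟶ H} (h : P = Q) : Hom₂.app (eqToHom h) = P.f₀ ≫ H.e := by
  subst h; rfl

theorem hom₂_ext {P Q : G ⟶ H} {α β : P ⟶ Q} (h : Hom₂.app α = Hom₂.app β) : α = β :=
  Hom₂.ext h

/-- Whiskering on the left. -/
def whiskerL (P : G ⟶ H) {Q R : H ⟶ K} (α : Q ⟶ R) : (P ≫ Q) ⟶ (P ≫ R) :=
  Hom₂.mk (P := P ≫ Q) (Q := P ≫ R) (P.f₀ ≫ α.app)
    (by simp [α.app_d]) (by simp [α.app_c]) (by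
      have := α.nat P.f₁
      simpa [← reassoc_of% P.f₁_c, ← reassoc_of% P.f₁_d] using this)

/-- Whiskering on the right. -/
def whiskerR {P Q : G ⟶ H} (α : P ⟶ Q) (R : H ⟶ K) : (P ≫ R) ⟶ (Q ≫ R) :=
  Hom₂.mk (P := P ≫ R) (Q := Q ≫ R) (α.app ≫ R.f₁)
    (by simp [R.f₁_d, reassoc_of% α.app_d]) (by simp [R.f₁_c, reassoc_of% α.app_c]) (by
      have h₁ := R.cmp_f₁ P.f₁ (G.c ≫ α.app) (by simp [P.f₁_c, α.app_d])
      have h₂ := R.cmp_f₁ (G.d ≫ α.app) Q.f₁ (by simp [Q.f₁_d, α.app_c])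
      simp only [Category.assoc] at h₁ h₂
      simp only [comp_f₁]
      rw [← h₁, ← h₂, α.naturality])

@[simp] theorem whiskerL_app (P : G ⟶ H) {Q R : H ⟶ K} (α : Q ⟶ R) :
    Hom₂.app (whiskerL P α) = P.f₀ ≫ α.app := rfl

@[simp] theorem whiskerR_app {P Q : G ⟶ H} (α : P ⟶ Q) (R : H ⟶ K) :
    Hom₂.app (whiskerR α R) = α.app ≫ R.f₁ := rfl

/-- Coherence isomorphisms are given by identities. -/
noncomputable def isoOfEq {P Q : G ⟶ H} (h : P = Q) : P ≅ Q where
  hom := Hom₂.ofEq h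
  inv := Hom₂.ofEq h.symm
  hom_inv_id := by subst h; exact Category.id_comp (𝟙 P)
  inv_hom_id := by subst h; exact Category.id_comp (𝟙 P)

@[simp] theorem isoOfEq_hom_app {P Q : G ⟶ H} (h : P = Q) :
    Hom₂.app (isoOfEq h).hom = P.f₀ ≫ H.e := rfl

@[simp] theorem isoOfEq_inv_app {P Q : G ⟶ H} (h : P = Q) :
    Hom₂.app (isoOfEq h).inv = Q.f₀ ≫ H.e := rfl

end

theorem strict_assoc {G H K L : IntGroupoid C} (P : G ⟶ H) (Q : H ⟶ K) (R : K ⟶ L) :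
    (P ≫ Q) ≫ R = P ≫ Q ≫ R := Hom.ext (by simp) (by simp)

theorem strict_id_comp {G H : IntGroupoid C} (P : G ⟶ H) : 𝟙 G ≫ P = P :=
  Hom.ext (by simp) (by simp)

theorem strict_comp_id {G H : IntGroupoid C} (P : G ⟶ H) : P ≫ 𝟙 H = P :=
  Hom.ext (by simp) (by simp)

/-- The 2-category of internal groupoids, internal functors and internal natural transformations. -/
noncomputable instance : Bicategory (IntGroupoid C) where
  whiskerLeft := whiskerL
  whiskerRight := whiskerR
  associator P Q R := isoOfEq (strict_assoc P Q R)
  leftUnitor P := isoOfEq (strict_id_comp P)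
  rightUnitor P := isoOfEq (strict_comp_id P)
  whiskerLeft_id P Q := by apply hom₂_ext; simp
  whiskerLeft_comp P _ _ _ α β := by apply hom₂_ext; simp [comp_cmp]
  id_whiskerLeft α := by apply hom₂_ext; simp [e_cmp, cmp_e]
  comp_whiskerLeft P Q _ _ α := by
    apply hom₂_ext; simp [unit_cmp, cmp_unit, e_d_assoc]
  id_whiskerRight P Q := by apply hom₂_ext; simp [Q.e_f₁]
  comp_whiskerRight α β R := by apply hom₂_ext; simp [Hom.cmp_f₁]
  whiskerRight_id α := by
    apply hom₂_ext; simp [unit_cmp, cmp_unit, e_d_assoc]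
  whiskerRight_comp α Q R := by
    apply hom₂_ext; simp [unit_cmp, cmp_unit, e_d_assoc]
  whisker_assoc P _ _ α R := by
    apply hom₂_ext; simp [unit_cmp, cmp_unit, e_d_assoc]
  whisker_exchange α β := by
    apply hom₂_ext
    have := Hom₂.nat β (Hom₂.app α)
    simp only [reassoc_of% α.app_d, reassoc_of% α.app_c] at this
    exact this.symm
  pentagon P Q R S := by
    apply hom₂_ext; simp [unit_cmp, e_d_assoc, Hom.e_f₁]
  triangle P Q := by
    apply hom₂_ext; simp [unit_cmp, e_d_assoc, Hom.e_f₁]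

instance : Bicategory.Strict (IntGroupoid C) where
  id_comp := strict_id_comp
  comp_id := strict_comp_id
  assoc := strict_assoc
  leftUnitor_eqToIso P := by
    apply Iso.ext; apply hom₂_ext; rw [eqToIso.hom, eqToHom_app]; rfl
  rightUnitor_eqToIso P := by
    apply Iso.ext; apply hom₂_ext; rw [eqToIso.hom, eqToHom_app]; rfl
  associator_eqToIso P Q R := by
    apply Iso.ext; apply hom₂_ext; rw [eqToIso.hom, eqToHom_app]; rfl

end IntGroupoid

/-! ## Consequences of protomodularity -/

section Protomodular

variable {C : Type u} [Category.{v} C] [HasZeroMorphisms C] [SemiAbelian C]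

/-- The kernel and the section of a split epimorphism are jointly epic. -/
theorem SemiAbelian.hom_ext {A B Z : C} (p : A ⟶ B) (s : B ⟶ A) (hs : s ≫ p = 𝟙 B) {f g : A ⟶ Z}
    (hk : kernel.ι p ≫ f = kernel.ι p ≫ g) (hsec : s ≫ f = s ≫ g) : f = g := by
  have hp : (equalizer.ι f g ≫ p) ≫ 𝟙 B = equalizer.ι f g ≫ p := by simp
  have hiso : IsIso (kernel.map (equalizer.ι f g ≫ p) p (equalizer.ι f g) (𝟙 B) hp) := by
    refine ⟨kernel.lift _ (equalizer.lift (kernel.ι p) hk) (by simp), ?_, ?_⟩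
    · ext; simp
    · ext; simp
  have := SemiAbelian.splitShortFive (equalizer.ι f g ≫ p) (equalizer.lift s hsec) (by simp [hs])
    p s hs (equalizer.ι f g) (𝟙 B) hp (by simp) inferInstance hiso
  exact (cancel_epi (equalizer.ι f g)).1 (equalizer.condition f g)

/-- A morphism of reflexive graphs between groupoids preserves the composition. -/
theorem ReflGraph.cmp_map {G H : IntGroupoid C} (f₀ : G.G₀ ⟶ H.G₀) (f₁ : G.G₁ ⟶ H.G₁)
    (hd : f₁ ≫ H.d = G.d ≫ f₀) (hc : f₁ ≫ H.c = G.c ≫ f₀) (he : G.e ≫ f₁ = f₀ ≫ H.e)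
    {T : C} (x y : T ⟶ G.G₁) (h : x ≫ G.c = y ≫ G.d) :
    G.cmp x y h ≫ f₁ =
      H.cmp (x ≫ f₁) (y ≫ f₁) (by simp [hc, hd, reassoc_of% h]) := by
  have key : G.cmp (pullback.fst G.c G.d) (pullback.snd G.c G.d) pullback.condition ≫ f₁ =
      H.cmp (pullback.fst G.c G.d ≫ f₁) (pullback.snd G.c G.d ≫ f₁)
        (by simp [hc, hd, pullback.condition_assoc]) := by
    refine SemiAbelian.hom_ext (pullback.fst G.c G.d)
      (pullback.lift (𝟙 _) (G.c ≫ G.e) (by simp [G.e_d])) (by simp) ?_ ?_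
    · rw [← Category.assoc, IntGroupoid.comp_cmp, IntGroupoid.comp_cmp,
        IntGroupoid.unit_cmp _ _ _ _ (by simp), IntGroupoid.unit_cmp _ _ _ _ (by simp)]
      simp
    · rw [← Category.assoc, IntGroupoid.comp_cmp, IntGroupoid.comp_cmp,
        IntGroupoid.cmp_unit _ _ _ _ (by simp [G.e_d_assoc]),
        IntGroupoid.cmp_unit _ _ _ _ (by simp [he, H.e_d_assoc])]
      simp
  have := congrArg (fun t => pullback.lift x y h ≫ t) key
  rw [← Category.assoc, IntGroupoid.comp_cmp] at this
  simpa only [IntGroupoid.comp_cmp, pullback.lift_fst, pullback.lift_snd, pullback.lift_fst_assoc,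
    pullback.lift_snd_assoc] using this

/-- There is at most one groupoid structure on a reflexive graph. -/
instance (Γ : ReflGraph C) : Subsingleton (GroupoidStructure Γ) := by
  refine ⟨fun S S' => ?_⟩
  have hm : S.m = S'.m := by
    have := ReflGraph.cmp_map (G := ⟨Γ, S⟩) (H := ⟨Γ, S'⟩) (𝟙 _) (𝟙 _) (by simp) (by simp)
      (by simp) (pullback.fst Γ.c Γ.d) (pullback.snd Γ.c Γ.d) pullback.condition
    have h1 : pullback.lift (pullback.fst Γ.c Γ.d) (pullback.snd Γ.c Γ.d) pullback.condition =
      𝟙 _ := by ext <;> simp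
    simpa [IntGroupoid.cmp, h1] using this
  have hi : S.i = S'.i := by
    let G : IntGroupoid C := ⟨Γ, S⟩
    have h1 : G.cmp (𝟙 _) S'.i (by simp [G, S'.i_d]) = Γ.d ≫ Γ.e := by
      rw [← S'.m_i, ← hm]; rfl
    have h2 : G.cmp S.i (𝟙 _) (by simp [G, S.i_c]) = Γ.c ≫ Γ.e := S.i_m
    have h3 := G.cmp_assoc S.i (𝟙 _) S'.i (by simp [G, S.i_c]) (by simp [G, S'.i_d])
    rw [G.cmp_congr _ h2 rfl, G.cmp_congr _ rfl h1] at h3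
    rw [G.e_cmp, G.cmp_e] at h3
    exact h3.symm
  cases S; cases S'
  simp only at hm hi
  subst hm hi
  rfl

end Protomodular

/-! ## Internal actions and the semi-direct product -/

section Actions

variable {C : Type u} [Category.{v} C] [HasZeroMorphisms C] [SemiAbelian C]

/-- The object `B ♭ X`, the kernel of `[1, 0] : B + X ⟶ B`. -/
noncomputable def flat (B X : C) : C := kernel (coprod.desc (𝟙 B) (0 : X ⟶ B))

/-- The inclusion `B ♭ X ⟶ B + X`. -/
noncomputable def flatι (B X : C) : flat B X ⟶ B ⨿ X := kernel.ι _

instance (B X : C) : Mono (flatι B X) := inferInstanceAs (Mono (kernel.ι _))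

theorem flatι_desc (B X : C) : flatι B X ≫ coprod.desc (𝟙 B) 0 = 0 := kernel.condition _

theorem flatι_desc' {B X Z : C} (f : B ⟶ Z) : flatι B X ≫ coprod.desc f 0 = 0 := by
  have : coprod.desc f (0 : X ⟶ Z) = coprod.desc (𝟙 B) 0 ≫ f := by ext <;> simp
  rw [this, reassoc_of% flatι_desc, zero_comp]

noncomputable def flatLift {T B X : C} (f : T ⟶ B ⨿ X) (h : f ≫ coprod.desc (𝟙 B) 0 = 0) :
    T ⟶ flat B X := kernel.lift _ f h

theorem flatLift_ι {T B X : C} (f : T ⟶ B ⨿ X) (h : f ≫ coprod.desc (𝟙 B) 0 = 0) :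
    flatLift f h ≫ flatι B X = f := kernel.lift_ι _ _ _

/-- The action of `♭` on morphisms. -/
noncomputable def flatMap {B X B' X' : C} (f : B ⟶ B') (g : X ⟶ X') : flat B X ⟶ flat B' X' :=
  flatLift (flatι B X ≫ coprod.map f g) (by simp [flatι_desc'])

theorem flatMap_ι {B X B' X' : C} (f : B ⟶ B') (g : X ⟶ X') :
    flatMap f g ≫ flatι B' X' = flatι B X ≫ coprod.map f g := flatLift_ι _ _

theorem flatMap_ι_assoc {B X B' X' Z : C} (f : B ⟶ B') (g : X ⟶ X') (h : B' ⨿ X' ⟶ Z) :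
    flatMap f g ≫ flatι B' X' ≫ h = flatι B X ≫ coprod.map f g ≫ h := by
  rw [reassoc_of% flatMap_ι]

/-- The unit `X ⟶ B ♭ X`. -/
noncomputable def flatUnit (B X : C) : X ⟶ flat B X := flatLift coprod.inr (by simp)

theorem flatUnit_ι (B X : C) : flatUnit B X ≫ flatι B X = coprod.inr := flatLift_ι _ _

/-- The multiplication `B ♭ (B ♭ X) ⟶ B ♭ X`. -/
noncomputable def flatMul (B X : C) : flat B (flat B X) ⟶ flat B X :=
  flatLift (flatι B (flat B X) ≫ coprod.desc coprod.inl (flatι B X))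
    (by simp [flatι_desc'])

theorem flatMul_ι (B X : C) : flatMul B X ≫ flatι B X =
    flatι B (flat B X) ≫ coprod.desc coprod.inl (flatι B X) := flatLift_ι _ _

/-- The monad `B ♭ -`, induced by the adjunction between `C` and the points over `B`. Its algebras
are the internal actions of `B`. -/
noncomputable abbrev flatMonad (B : C) : Monad C where
  obj X := flat B X
  map g := flatMap (𝟙 B) g
  map_id X := by
    rw [← cancel_mono (flatι B _), flatMap_ι]; simp
  map_comp f g := by
    rw [← cancel_mono (flatι B _), flatMap_ι, Category.assoc, flatMap_ι, flatMap_ι_assoc]; simp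
  η :=
    { app := flatUnit B
      naturality := fun X Y f => by
        dsimp
        rw [← cancel_mono (flatι B _), Category.assoc, Category.assoc, flatUnit_ι, flatMap_ι,
          reassoc_of% flatUnit_ι]; simp }
  μ :=
    { app := flatMul B
      naturality := fun X Y f => by
        dsimp
        rw [← cancel_mono (flatι B _), Category.assoc, Category.assoc, flatMul_ι, flatMap_ι,
          flatMap_ι_assoc, reassoc_of% flatMul_ι]
        congr 1
        ext <;> simp [flatMap_ι] }
  assoc X := by
    dsimp
    rw [← cancel_mono (flatι B _), Category.assoc, Category.assoc, flatMul_ι,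
      flatMap_ι_assoc, reassoc_of% flatMul_ι]
    congr 1
    ext <;> simp [flatMul_ι]
  left_unit X := by
    dsimp
    rw [← cancel_mono (flatι B _), Category.assoc, flatMul_ι, reassoc_of% flatUnit_ι]
    simp
  right_unit X := by
    dsimp
    rw [← cancel_mono (flatι B _), Category.assoc, flatMul_ι, flatMap_ι_assoc]
    have : coprod.map (𝟙 B) (flatUnit B X) ≫ coprod.desc coprod.inl (flatι B X) = 𝟙 _ := by
      ext <;> simp [flatUnit_ι]
    rw [this]; simp

/-- The conjugation action `χ` of an object on itself. -/
noncomputable def conj (A : C) : flat A A ⟶ A := flatι A A ≫ coprod.desc (𝟙 A) (𝟙 A)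

end Actions

variable (C : Type u) [Category.{v} C] [HasZeroMorphisms C] [SemiAbelian C] in
/-- The coequalizers defining the semi-direct products of internal actions exist. -/
class HasSemidirectProducts : Prop where
  hasCoequalizer (B : C) (A : (flatMonad B).Algebra) :
    HasCoequalizer (flatι B A.A) ((show flat B A.A ⟶ A.A from A.a) ≫ coprod.inr)

/-! ## Internal crossed modules -/

/-- An internal crossed module `∂ : G ⟶ G₀`, with an internal action of `G₀` on `G` given by
`act`, satisfying the Peiffer condition and the precrossed module condition. -/
structure XMod (C : Type u) [Category.{v} C] [HasZeroMorphisms C] [SemiAbelian C] where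
  base : C
  act : (flatMonad base).Algebra
  bd : act.A ⟶ base
  peiffer : flatMap bd (𝟙 act.A) ≫ act.a = conj act.A
  precrossed : act.a ≫ bd = flatMap (𝟙 base) bd ≫ conj base

namespace XMod

section
variable {C : Type u} [Category.{v} C] [HasZeroMorphisms C] [SemiAbelian C]

/-- The top object `G` of a crossed module `∂ : G ⟶ G₀`. -/
abbrev top (X : XMod C) : C := X.act.A

/-- The structure morphism of the action. -/
abbrev ξ (X : XMod C) : flat X.base X.top ⟶ X.top := X.act.a

theorem ξ_bd (X : XMod C) : X.ξ ≫ X.bd = flatι X.base X.top ≫ coprod.desc (𝟙 _) X.bd := by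
  have := X.precrossed
  rw [conj, flatMap_ι_assoc] at this
  exact this.trans (by simp)

/-- A morphism of crossed modules. -/
@[ext]
structure Hom (X Y : XMod C) where
  p : X.top ⟶ Y.top
  p₀ : X.base ⟶ Y.base
  equivariant : flatMap p₀ p ≫ Y.ξ = X.ξ ≫ p
  bd_p : X.bd ≫ p₀ = p ≫ Y.bd

instance : CategoryStruct (XMod C) where
  Hom := Hom
  id X :=
    { p := 𝟙 _
      p₀ := 𝟙 _
      equivariant := by
        have : flatMap (𝟙 X.base) (𝟙 X.top) = 𝟙 _ := (flatMonad X.base).map_id X.top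
        rw [this]; simp
      bd_p := by simp }
  comp {X Y Z} P Q :=
    { p := P.p ≫ Q.p
      p₀ := P.p₀ ≫ Q.p₀
      equivariant := by
        have : flatMap (P.p₀ ≫ Q.p₀) (P.p ≫ Q.p) = flatMap P.p₀ P.p ≫ flatMap Q.p₀ Q.p := by
          rw [← cancel_mono (flatι _ _), Category.assoc, flatMap_ι, flatMap_ι, flatMap_ι_assoc]
          simp
        rw [this, Category.assoc, Q.equivariant, reassoc_of% P.equivariant]
      bd_p := by rw [reassoc_of% P.bd_p, Q.bd_p, Category.assoc] }

section
variable {X Y Z : XMod C}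
@[simp] theorem id_p : Hom.p (𝟙 X) = 𝟙 _ := rfl
@[simp] theorem id_p₀ : Hom.p₀ (𝟙 X) = 𝟙 _ := rfl
@[simp] theorem comp_p (P : X ⟶ Y) (Q : Y ⟶ Z) : Hom.p (P ≫ Q) = P.p ≫ Q.p := rfl
@[simp] theorem comp_p₀ (P : X ⟶ Y) (Q : Y ⟶ Z) : Hom.p₀ (P ≫ Q) = P.p₀ ≫ Q.p₀ := rfl
end

theorem strict_assoc {X Y Z W : XMod C} (P : X ⟶ Y) (Q : Y ⟶ Z) (R : Z ⟶ W) :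
    (P ≫ Q) ≫ R = P ≫ Q ≫ R := Hom.ext (by simp) (by simp)

theorem strict_id_comp {X Y : XMod C} (P : X ⟶ Y) : 𝟙 X ≫ P = P :=
  Hom.ext (by simp) (by simp)

theorem strict_comp_id {X Y : XMod C} (P : X ⟶ Y) : P ≫ 𝟙 Y = P :=
  Hom.ext (by simp) (by simp)

end

section Semidirect
variable {C : Type u} [Category.{v} C] [HasZeroMorphisms C] [SemiAbelian C]
  [HasSemidirectProducts C]

instance (X : XMod C) : HasCoequalizer (flatι X.base X.top) (X.ξ ≫ coprod.inr) :=
  HasSemidirectProducts.hasCoequalizer X.base X.act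

/-- The semi-direct product `G ⋊ G₀`. -/
noncomputable def sd (X : XMod C) : C := coequalizer (flatι X.base X.top) (X.ξ ≫ coprod.inr)

/-- The quotient `G₀ + G ⟶ G ⋊ G₀`. -/
noncomputable def q (X : XMod C) : X.base ⨿ X.top ⟶ X.sd := coequalizer.π _ _

instance (X : XMod C) : Epi X.q := inferInstanceAs (Epi (coequalizer.π _ _))

theorem ι_q (X : XMod C) : flatι X.base X.top ≫ X.q = X.ξ ≫ coprod.inr ≫ X.q := by
  have := coequalizer.condition (flatι X.base X.top) (X.ξ ≫ coprod.inr)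
  rwa [Category.assoc] at this

/-- The morphism `G ⋊ G₀ ⟶ Z` induced by `a : G₀ ⟶ Z` and `b : G ⟶ Z`. -/
noncomputable def desc (X : XMod C) {Z : C} (a : X.base ⟶ Z) (b : X.top ⟶ Z)
    (h : flatι X.base X.top ≫ coprod.desc a b = X.ξ ≫ b) : X.sd ⟶ Z :=
  coequalizer.desc (coprod.desc a b) (by simp [h])

theorem q_desc (X : XMod C) {Z : C} (a : X.base ⟶ Z) (b : X.top ⟶ Z)
    (h : flatι X.base X.top ≫ coprod.desc a b = X.ξ ≫ b) :
    X.q ≫ X.desc a b h = coprod.desc a b := coequalizer.π_desc _ _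

/-- The canonical morphism `g : G ⟶ G ⋊ G₀`. -/
noncomputable def g (X : XMod C) : X.top ⟶ X.sd := coprod.inr ≫ X.q

theorem g_desc (X : XMod C) {Z : C} (a : X.base ⟶ Z) (b : X.top ⟶ Z)
    (h : flatι X.base X.top ≫ coprod.desc a b = X.ξ ≫ b) : X.g ≫ X.desc a b h = b := by
  rw [g, Category.assoc, q_desc, coprod.inr_desc]

theorem inl_q_desc (X : XMod C) {Z : C} (a : X.base ⟶ Z) (b : X.top ⟶ Z)
    (h : flatι X.base X.top ≫ coprod.desc a b = X.ξ ≫ b) :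
    (coprod.inl ≫ X.q) ≫ X.desc a b h = a := by
  rw [Category.assoc, q_desc, coprod.inl_desc]

theorem sd_hom_ext (X : XMod C) {Z : C} {f f' : X.sd ⟶ Z}
    (he : (coprod.inl ≫ X.q) ≫ f = (coprod.inl ≫ X.q) ≫ f') (hg : X.g ≫ f = X.g ≫ f') :
    f = f' := by
  rw [← cancel_epi X.q]
  apply coprod.hom_ext
  · simpa using he
  · simpa [g] using hg

/-- The codomain morphism: the projection of the semi-direct product. -/
noncomputable def c (X : XMod C) : X.sd ⟶ X.base :=
  X.desc (𝟙 _) 0 (by rw [flatι_desc', comp_zero])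

/-- The domain morphism, determined by `g ≫ d = ∂` and `e ≫ d = 1`. -/
noncomputable def d (X : XMod C) : X.sd ⟶ X.base := X.desc (𝟙 _) X.bd X.ξ_bd.symm

/-- The injection of `G₀` in the semi-direct product. -/
noncomputable def e (X : XMod C) : X.base ⟶ X.sd := coprod.inl ≫ X.q

theorem e_d (X : XMod C) : X.e ≫ X.d = 𝟙 _ := X.inl_q_desc _ _ _

theorem e_c (X : XMod C) : X.e ≫ X.c = 𝟙 _ := X.inl_q_desc _ _ _

theorem g_d (X : XMod C) : X.g ≫ X.d = X.bd := X.g_desc _ _ _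

theorem g_c (X : XMod C) : X.g ≫ X.c = 0 := X.g_desc _ _ _

theorem e_d_assoc (X : XMod C) {Z : C} (f : X.base ⟶ Z) : X.e ≫ X.d ≫ f = f := by
  rw [reassoc_of% X.e_d]

/-- The reflexive graph `G ⋊ G₀ ⇉ G₀` of a crossed module. -/
noncomputable abbrev graph (X : XMod C) : ReflGraph C where
  G₀ := X.base
  G₁ := X.sd
  d := X.d
  c := X.c
  e := X.e
  e_d := X.e_d
  e_c := X.e_c

/-- The morphism `H ⋊ H₀ ⟶ G ⋊ G₀` induced by a morphism of crossed modules. -/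
noncomputable def Hom.p₁ {X Y : XMod C} (P : Hom X Y) : X.sd ⟶ Y.sd :=
  X.desc (P.p₀ ≫ Y.e) (P.p ≫ Y.g) (by
    have h := Y.ι_q
    have : coprod.desc (P.p₀ ≫ Y.e) (P.p ≫ Y.g) = coprod.map P.p₀ P.p ≫ Y.q := by
      ext <;> simp [g, e]
    rw [this, ← flatMap_ι_assoc, h, reassoc_of% P.equivariant]
    rfl)

theorem Hom.g_p₁ {X Y : XMod C} (P : Hom X Y) : X.g ≫ P.p₁ = P.p ≫ Y.g := X.g_desc _ _ _

theorem Hom.e_p₁ {X Y : XMod C} (P : Hom X Y) : X.e ≫ P.p₁ = P.p₀ ≫ Y.e :=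
  X.inl_q_desc _ _ _

theorem Hom.p₁_d {X Y : XMod C} (P : Hom X Y) : P.p₁ ≫ Y.d = X.d ≫ P.p₀ := by
  apply X.sd_hom_ext
  · change X.e ≫ _ = X.e ≫ _
    rw [reassoc_of% P.e_p₁, Y.e_d, reassoc_of% X.e_d, Category.comp_id]
  · rw [reassoc_of% P.g_p₁, g_d, reassoc_of% X.g_d, P.bd_p]

theorem Hom.p₁_c {X Y : XMod C} (P : Hom X Y) : P.p₁ ≫ Y.c = X.c ≫ P.p₀ := by
  apply X.sd_hom_ext
  · change X.e ≫ _ = X.e ≫ _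
    rw [reassoc_of% P.e_p₁, Y.e_c, reassoc_of% X.e_c, Category.comp_id]
  · rw [reassoc_of% P.g_p₁, g_c, reassoc_of% X.g_c, comp_zero, zero_comp]

theorem id_p₁ (X : XMod C) : Hom.p₁ (𝟙 X) = 𝟙 _ := by
  apply X.sd_hom_ext
  · change X.e ≫ _ = X.e ≫ _
    rw [Hom.e_p₁]; simp
  · rw [Hom.g_p₁]; simp

theorem comp_p₁ {X Y Z : XMod C} (P : X ⟶ Y) (Q : Y ⟶ Z) :
    Hom.p₁ (P ≫ Q) = Hom.p₁ P ≫ Hom.p₁ Q := by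
  apply X.sd_hom_ext
  · change X.e ≫ _ = X.e ≫ _
    rw [Hom.e_p₁, reassoc_of% (Hom.e_p₁ P), Hom.e_p₁]; simp
  · rw [Hom.g_p₁, reassoc_of% (Hom.g_p₁ P), Hom.g_p₁]; simp

end Semidirect

end XMod

/-! ## The normalization of an internal groupoid -/

namespace IntGroupoid

variable {C : Type u} [Category.{v} C] [HasZeroMorphisms C] [SemiAbelian C]

/-- The action of `G₀` on the kernel of `c`, by conjugation in `G₁`: the restriction of `[e, g]`. -/
noncomputable def normAct (G : IntGroupoid C) : flat G.G₀ (kernel G.c) ⟶ kernel G.c :=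
  kernel.lift G.c (flatι _ _ ≫ coprod.desc G.e (kernel.ι G.c)) (by
    have : coprod.desc G.e (kernel.ι G.c) ≫ G.c = coprod.desc (𝟙 _) 0 := by
      ext <;> simp [G.e_c]
    rw [Category.assoc, this, flatι_desc])

theorem normAct_ι (G : IntGroupoid C) :
    G.normAct ≫ kernel.ι G.c = flatι _ _ ≫ coprod.desc G.e (kernel.ι G.c) :=
  kernel.lift_ι _ _ _

/-- In a groupoid, conjugation by an arrow of `ker c` agrees with the action of its domain. -/
theorem peiffer (G : IntGroupoid C) :
    flatMap (kernel.ι G.c ≫ G.d) (𝟙 (kernel G.c)) ≫ G.normAct = conj (kernel G.c) := by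
  let k := kernel.ι G.c
  have hk : k ≫ G.c = 0 := kernel.condition _
  rw [← cancel_mono k, Category.assoc, normAct_ι, flatMap_ι_assoc, conj, Category.assoc]
  have hx : coprod.map (k ≫ G.d) (𝟙 _) ≫ coprod.desc G.e k = coprod.desc (k ≫ G.d ≫ G.e) k := by
    ext <;> simp
  have hw : coprod.desc (k ≫ G.d ≫ G.e) k ≫ G.c = coprod.desc k 0 ≫ G.d := by
    ext <;> simp [G.e_c, hk]
  have h1 : coprod.desc (𝟙 _) (𝟙 _) ≫ k = G.cmp (coprod.desc (k ≫ G.d ≫ G.e) k)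
      (coprod.desc k 0) hw := by
    apply coprod.hom_ext
    · rw [comp_cmp, unit_cmp _ _ _ _ (by simp [e_d_assoc])]; simp
    · rw [comp_cmp, cmp_unit _ _ _ _ (by simp)]; simp
  change flatι _ _ ≫ coprod.map (k ≫ G.d) (𝟙 _) ≫ coprod.desc G.e k =
    flatι _ _ ≫ coprod.desc (𝟙 _) (𝟙 _) ≫ k
  rw [hx, h1, comp_cmp, cmp_unit _ _ _ _ (by simp [flatι_desc'])]

/-- The crossed module of an internal groupoid: `ker c ⟶ G₁ ⟶ G₀`, with the action `normAct`. -/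
noncomputable abbrev normalize (G : IntGroupoid C) : XMod C where
  base := G.G₀
  act :=
    { A := kernel G.c
      a := G.normAct
      unit := by
        change flatUnit _ _ ≫ G.normAct = _
        rw [← cancel_mono (kernel.ι G.c), Category.assoc, normAct_ι, reassoc_of% flatUnit_ι]
        simp
      assoc := by
        change flatMul _ _ ≫ G.normAct = flatMap (𝟙 _) G.normAct ≫ G.normAct
        rw [← cancel_mono (kernel.ι G.c), Category.assoc, Category.assoc, normAct_ι,
          reassoc_of% flatMul_ι, flatMap_ι_assoc]
        congr 1
        ext <;> simp [normAct_ι] }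
  bd := kernel.ι G.c ≫ G.d
  peiffer := G.peiffer
  precrossed := by
    change G.normAct ≫ kernel.ι G.c ≫ G.d = flatMap (𝟙 G.G₀) (kernel.ι G.c ≫ G.d) ≫ conj G.G₀
    rw [reassoc_of% G.normAct_ι, conj, flatMap_ι_assoc]
    congr 1
    ext <;> simp [G.e_d]

/-- The morphism of crossed modules of an internal functor. -/
noncomputable abbrev normalizeMap {G H : IntGroupoid C} (P : G ⟶ H) : G.normalize ⟶ H.normalize :=
  XMod.Hom.mk (X := G.normalize) (Y := H.normalize)
    (kernel.map G.c H.c P.f₁ P.f₀ P.f₁_c.symm) P.f₀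
    (by
      change flatMap _ _ ≫ H.normAct = G.normAct ≫ _
      rw [← cancel_mono (kernel.ι H.c), Category.assoc, Category.assoc, normAct_ι,
        flatMap_ι_assoc, kernel.lift_ι, reassoc_of% normAct_ι]
      congr 1
      ext <;> simp [P.e_f₁])
    (by
      change (kernel.ι G.c ≫ G.d) ≫ P.f₀ = kernel.map _ _ _ _ _ ≫ kernel.ι H.c ≫ H.d
      simp [P.f₁_d])

/-- The canonical comparison `ker c ⋊ G₀ ⟶ G₁`, induced by `[e, g]`. -/
noncomputable def comparison [HasSemidirectProducts C] (G : IntGroupoid C) :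
    G.normalize.sd ⟶ G.G₁ :=
  G.normalize.desc G.e (kernel.ι G.c) G.normAct_ι.symm

end IntGroupoid

/-! ## The 2-category of crossed modules -/

/-- The facts on which the 2-category of crossed modules rests: the reflexive graph of a crossed
module has a (necessarily unique) groupoid structure, and the semi-direct product recovers the
object of arrows of a groupoid. -/
class HasDenormalization (C : Type u) [Category.{v} C] [HasZeroMorphisms C] [SemiAbelian C]
    [HasSemidirectProducts C] : Prop where
  groupoid (X : XMod C) : Nonempty (GroupoidStructure X.graph)
  comparison (G : IntGroupoid C) : IsIso G.comparison

attribute [instance] HasDenormalization.comparison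

namespace XMod

variable {C : Type u} [Category.{v} C] [HasZeroMorphisms C] [SemiAbelian C]
  [HasSemidirectProducts C] [HasDenormalization C]

/-- The internal groupoid of a crossed module. -/
noncomputable abbrev denormalize (X : XMod C) : IntGroupoid C where
  toReflGraph := X.graph
  str := (HasDenormalization.groupoid X).some

/-- The morphism `g • = g ≫ i`, where `i` gives the inverses in the groupoid. -/
noncomputable def gInv (X : XMod C) : X.top ⟶ X.sd := X.g ≫ X.denormalize.str.i

/-- Composition of generalized arrows `T ⟶ G ⋊ G₀` in the groupoid of a crossed module. -/
noncomputable def cmp (X : XMod C) {T : C} (x y : T ⟶ X.sd) (h : x ≫ X.c = y ≫ X.d) : T ⟶ X.sd :=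
  X.denormalize.cmp x y h

section
variable (X : XMod C) {T : C}

theorem cmp_d (x y : T ⟶ X.sd) (h : x ≫ X.c = y ≫ X.d) : X.cmp x y h ≫ X.d = x ≫ X.d :=
  X.denormalize.cmp_d x y h

theorem cmp_c (x y : T ⟶ X.sd) (h : x ≫ X.c = y ≫ X.d) : X.cmp x y h ≫ X.c = y ≫ X.c :=
  X.denormalize.cmp_c x y h

theorem cmp_assoc (x y z : T ⟶ X.sd) (hxy : x ≫ X.c = y ≫ X.d) (hyz : y ≫ X.c = z ≫ X.d) :
    X.cmp (X.cmp x y hxy) z ((X.cmp_c x y hxy).trans hyz) =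
      X.cmp x (X.cmp y z hyz) (hxy.trans (X.cmp_d y z hyz).symm) :=
  X.denormalize.cmp_assoc x y z hxy hyz

theorem comp_cmp {S : C} (t : S ⟶ T) (x y : T ⟶ X.sd) (h : x ≫ X.c = y ≫ X.d) :
    t ≫ X.cmp x y h = X.cmp (t ≫ x) (t ≫ y) (by simp [h]) :=
  X.denormalize.comp_cmp t x y h

theorem unit_cmp (w x : T ⟶ X.sd) (h : w ≫ X.c = x ≫ X.d) (hw : w = w ≫ X.d ≫ X.e) :
    X.cmp w x h = x :=
  X.denormalize.unit_cmp w x h hw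

theorem cmp_unit (x w : T ⟶ X.sd) (h : x ≫ X.c = w ≫ X.d) (hw : w = w ≫ X.d ≫ X.e) :
    X.cmp x w h = x :=
  X.denormalize.cmp_unit x w h hw

theorem cmp_congr {x x' y y' : T ⟶ X.sd} (h : x ≫ X.c = y ≫ X.d) (hx : x = x') (hy : y = y') :
    X.cmp x y h = X.cmp x' y' (by rw [← hx, ← hy, h]) := by
  subst hx hy; rfl

end

theorem Hom.cmp_p₁ {X Y : XMod C} (P : Hom X Y) {T : C} (x y : T ⟶ X.sd)
    (h : x ≫ X.c = y ≫ X.d) :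
    X.cmp x y h ≫ P.p₁ = Y.cmp (x ≫ P.p₁) (y ≫ P.p₁) (by
      simp [P.p₁_c, P.p₁_d, reassoc_of% h]) :=
  ReflGraph.cmp_map (G := X.denormalize) (H := Y.denormalize) P.p₀ P.p₁ P.p₁_d P.p₁_c P.e_p₁ x y h

/-- A 2-cell between parallel morphisms of crossed modules: an arrow `α : H₀ ⟶ G ⋊ G₀` with
domain `p₀` and codomain `q₀`, such that `p ≫ g = ⟨∂ ≫ α, q ≫ g⟩ ≫ m`. -/
@[ext]
structure Hom₂ {X Y : XMod C} (P Q : Hom X Y) where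
  app : X.base ⟶ Y.sd
  app_d : app ≫ Y.d = P.p₀
  app_c : app ≫ Y.c = Q.p₀
  star : P.p ≫ Y.g =
    pullback.lift (X.bd ≫ app) (Q.p ≫ Y.g)
      (by rw [Category.assoc, Category.assoc, app_c, g_d, Q.bd_p]) ≫ Y.denormalize.str.m

theorem Hom₂.star' {X Y : XMod C} {P Q : Hom X Y} (α : Hom₂ P Q) :
    P.p ≫ Y.g = Y.cmp (X.bd ≫ α.app) (Q.p ≫ Y.g)
      (by rw [Category.assoc, Category.assoc, α.app_c, g_d, Q.bd_p]) := α.star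

/-- A 2-cell is natural with respect to the internal functors induced by the two morphisms. -/
theorem Hom₂.naturality {X Y : XMod C} {P Q : Hom X Y} (α : Hom₂ P Q) :
    Y.cmp P.p₁ (X.c ≫ α.app) (by simp [P.p₁_c, α.app_d]) =
      Y.cmp (X.d ≫ α.app) Q.p₁ (by simp [Q.p₁_d, α.app_c]) := by
  apply X.sd_hom_ext
  · change X.e ≫ _ = X.e ≫ _
    rw [comp_cmp, comp_cmp, unit_cmp, cmp_unit]
    · rw [reassoc_of% X.e_c, reassoc_of% X.e_d]
    · rw [Q.e_p₁, Category.assoc, e_d_assoc]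
    · rw [P.e_p₁, Category.assoc, e_d_assoc]
  · rw [comp_cmp, comp_cmp, cmp_unit _ _ _ _ (by rw [reassoc_of% X.g_c]; simp), P.g_p₁, α.star']
    apply cmp_congr
    · rw [reassoc_of% X.g_d]
    · rw [Q.g_p₁]

theorem Hom₂.nat {X Y : XMod C} {P Q : Hom X Y} (α : Hom₂ P Q) {T : C} (x : T ⟶ X.sd) :
    Y.cmp (x ≫ P.p₁) (x ≫ X.c ≫ α.app) (by simp [P.p₁_c, α.app_d]) =
      Y.cmp (x ≫ X.d ≫ α.app) (x ≫ Q.p₁) (by simp [Q.p₁_d, α.app_c]) := by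
  rw [← comp_cmp _ x P.p₁ (X.c ≫ α.app) (by simp [P.p₁_c, α.app_d]), α.naturality, comp_cmp]

/-- The identity 2-cell; more generally, the one given by an equality. -/
noncomputable def Hom₂.ofEq {X Y : XMod C} {P Q : Hom X Y} (h : P = Q) : Hom₂ P Q where
  app := P.p₀ ≫ Y.e
  app_d := by simp [Y.e_d]
  app_c := by simp [Y.e_c, h]
  star := by
    subst h
    exact (Y.unit_cmp (X.bd ≫ P.p₀ ≫ Y.e) (P.p ≫ Y.g)
      (by simp [Y.e_c, Y.g_d, P.bd_p]) (by simp [e_d_assoc])).symm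

/-- Vertical composition of 2-cells. -/
noncomputable def Hom₂.comp {X Y : XMod C} {P Q R : Hom X Y} (α : Hom₂ P Q)
    (β : Hom₂ Q R) : Hom₂ P R where
  app := Y.cmp α.app β.app (by rw [α.app_c, β.app_d])
  app_d := by rw [cmp_d, α.app_d]
  app_c := by rw [cmp_c, β.app_c]
  star := by
    have e₁ := Y.cmp_assoc (X.bd ≫ α.app) (X.bd ≫ β.app) (R.p ≫ Y.g)
      (by simp [α.app_c, β.app_d])
      (by rw [Category.assoc, Category.assoc, β.app_c, g_d, R.bd_p])
    refine α.star'.trans ((Y.cmp_congr _ rfl β.star').trans (e₁.symm.trans ?_))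
    exact Y.cmp_congr _ (Y.comp_cmp _ _ _ _).symm rfl

noncomputable instance (X Y : XMod C) : Category (X ⟶ Y) where
  Hom P Q := Hom₂ P Q
  id _ := Hom₂.ofEq rfl
  comp := Hom₂.comp
  id_comp _ := Hom₂.ext (Y.unit_cmp _ _ _ (by simp [Hom₂.ofEq, e_d_assoc]))
  comp_id _ := Hom₂.ext (Y.cmp_unit _ _ _ (by simp [Hom₂.ofEq, e_d_assoc]))
  assoc _ _ _ := Hom₂.ext (Y.cmp_assoc _ _ _ _ _)

section
variable {X Y Z : XMod C}

@[simp] theorem id_app (P : X ⟶ Y) : Hom₂.app (𝟙 P) = P.p₀ ≫ Y.e := rfl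

@[simp] theorem comp_app {P Q R : X ⟶ Y} (α : P ⟶ Q) (β : Q ⟶ R) :
    Hom₂.app (α ≫ β) = Y.cmp α.app β.app (by rw [α.app_c, β.app_d]) := rfl

theorem eqToHom_app {P Q : X ⟶ Y} (h : P = Q) : Hom₂.app (eqToHom h) = P.p₀ ≫ Y.e := by
  subst h; rfl

theorem eqToHom_comp_app {P Q R : X ⟶ Y} (h : P = Q) (α : Q ⟶ R) :
    Hom₂.app (eqToHom h ≫ α) = α.app := by
  subst h; rw [eqToHom_refl, Category.id_comp]

theorem comp_eqToHom_app {P Q R : X ⟶ Y} (α : P ⟶ Q) (h : Q = R) :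
    Hom₂.app (α ≫ eqToHom h) = α.app := by
  subst h; rw [eqToHom_refl, Category.comp_id]

theorem hom₂_ext {P Q : X ⟶ Y} {α β : P ⟶ Q} (h : Hom₂.app α = Hom₂.app β) : α = β :=
  Hom₂.ext h

/-- Whiskering on the left. -/
noncomputable def whiskerL (P : X ⟶ Y) {Q R : Y ⟶ Z} (α : Q ⟶ R) : (P ≫ Q) ⟶ (P ≫ R) :=
  Hom₂.mk (P := P ≫ Q) (Q := P ≫ R) (P.p₀ ≫ α.app)
    (by simp [α.app_d]) (by simp [α.app_c]) (by
      have h := P.p ≫= α.star'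
      rw [comp_cmp] at h
      refine (Category.assoc _ _ _).trans (h.trans (Z.cmp_congr _ ?_ ?_))
      · rw [← reassoc_of% P.bd_p]
      · exact (Category.assoc _ _ _).symm)

/-- Whiskering on the right. -/
noncomputable def whiskerR {P Q : X ⟶ Y} (α : P ⟶ Q) (R : Y ⟶ Z) : (P ≫ R) ⟶ (Q ≫ R) :=
  Hom₂.mk (P := P ≫ R) (Q := Q ≫ R) (α.app ≫ R.p₁)
    (by simp [R.p₁_d, reassoc_of% α.app_d]) (by simp [R.p₁_c, reassoc_of% α.app_c]) (by
      have h := α.star' =≫ R.p₁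
      rw [R.cmp_p₁, Category.assoc, R.g_p₁] at h
      refine (Category.assoc _ _ _).trans (h.trans (Z.cmp_congr _ ?_ ?_))
      · exact Category.assoc _ _ _
      · rw [Category.assoc, R.g_p₁]; exact (Category.assoc _ _ _).symm)

@[simp] theorem whiskerL_app (P : X ⟶ Y) {Q R : Y ⟶ Z} (α : Q ⟶ R) :
    Hom₂.app (whiskerL P α) = P.p₀ ≫ α.app := rfl

@[simp] theorem whiskerR_app {P Q : X ⟶ Y} (α : P ⟶ Q) (R : Y ⟶ Z) :
    Hom₂.app (whiskerR α R) = α.app ≫ R.p₁ := rfl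

/-- Coherence isomorphisms are given by identities. -/
noncomputable def isoOfEq {P Q : X ⟶ Y} (h : P = Q) : P ≅ Q where
  hom := Hom₂.ofEq h
  inv := Hom₂.ofEq h.symm
  hom_inv_id := by subst h; exact Category.id_comp (𝟙 P)
  inv_hom_id := by subst h; exact Category.id_comp (𝟙 P)

@[simp] theorem isoOfEq_hom_app {P Q : X ⟶ Y} (h : P = Q) :
    Hom₂.app (isoOfEq h).hom = P.p₀ ≫ Y.e := rfl

@[simp] theorem isoOfEq_inv_app {P Q : X ⟶ Y} (h : P = Q) :
    Hom₂.app (isoOfEq h).inv = Q.p₀ ≫ Y.e := rfl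

end

/-- The 2-category of internal crossed modules. -/
noncomputable instance : Bicategory (XMod C) where
  whiskerLeft := whiskerL
  whiskerRight := whiskerR
  associator P Q R := isoOfEq (strict_assoc P Q R)
  leftUnitor P := isoOfEq (strict_id_comp P)
  rightUnitor P := isoOfEq (strict_comp_id P)
  whiskerLeft_id P Q := by apply hom₂_ext; simp
  whiskerLeft_comp P _ _ _ α β := by apply hom₂_ext; simp [comp_cmp]
  id_whiskerLeft α := by apply hom₂_ext; simp [unit_cmp, cmp_unit, e_d_assoc]
  comp_whiskerLeft P Q _ _ α := by
    apply hom₂_ext; simp [unit_cmp, cmp_unit, e_d_assoc]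
  id_whiskerRight P Q := by apply hom₂_ext; simp [Hom.e_p₁]
  comp_whiskerRight α β R := by apply hom₂_ext; simp [Hom.cmp_p₁]
  whiskerRight_id α := by
    apply hom₂_ext; simp [unit_cmp, cmp_unit, e_d_assoc, id_p₁]
  whiskerRight_comp α Q R := by
    apply hom₂_ext; simp [unit_cmp, cmp_unit, e_d_assoc, comp_p₁]
  whisker_assoc P _ _ α R := by
    apply hom₂_ext; simp [unit_cmp, cmp_unit, e_d_assoc]
  whisker_exchange α β := by
    apply hom₂_ext
    have := Hom₂.nat β (Hom₂.app α)
    simp only [reassoc_of% α.app_d, reassoc_of% α.app_c] at this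
    exact this.symm
  pentagon P Q R S := by
    apply hom₂_ext; simp [unit_cmp, e_d_assoc, Hom.e_p₁]
  triangle P Q := by
    apply hom₂_ext; simp [unit_cmp, e_d_assoc, Hom.e_p₁]

instance : Bicategory.Strict (XMod C) where
  id_comp := strict_id_comp
  comp_id := strict_comp_id
  assoc := strict_assoc
  leftUnitor_eqToIso P := by
    apply Iso.ext; apply hom₂_ext; rw [eqToIso.hom, eqToHom_app]; rfl
  rightUnitor_eqToIso P := by
    apply Iso.ext; apply hom₂_ext; rw [eqToIso.hom, eqToHom_app]; rfl
  associator_eqToIso P Q R := by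
    apply Iso.ext; apply hom₂_ext; rw [eqToIso.hom, eqToHom_app]; rfl

end XMod

/-! ## The normalization 2-functor -/

namespace IntGroupoid

variable {C : Type u} [Category.{v} C] [HasZeroMorphisms C] [SemiAbelian C]

theorem normalizeMap_p_ι {G H : IntGroupoid C} (P : G ⟶ H) :
    (normalizeMap P).p ≫ kernel.ι H.c = kernel.ι G.c ≫ P.f₁ := kernel.lift_ι _ _ _

theorem normalizeMap_id (G : IntGroupoid C) : normalizeMap (𝟙 G) = 𝟙 G.normalize := by
  apply XMod.Hom.ext
  · change (normalizeMap (𝟙 G)).p = 𝟙 (kernel G.c)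
    rw [← cancel_mono (kernel.ι G.c)]
    exact (kernel.lift_ι _ _ _).trans (by simp)
  · rfl

theorem normalizeMap_comp {G H K : IntGroupoid C} (P : G ⟶ H) (Q : H ⟶ K) :
    normalizeMap (P ≫ Q) = normalizeMap P ≫ normalizeMap Q := by
  apply XMod.Hom.ext
  · change (normalizeMap (P ≫ Q)).p = (normalizeMap P).p ≫ (normalizeMap Q).p
    rw [← cancel_mono (kernel.ι K.c), Category.assoc, normalizeMap_p_ι, normalizeMap_p_ι,
      reassoc_of% normalizeMap_p_ι P]
    simp
  · rfl

section
variable [HasSemidirectProducts C]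

theorem e_comparison (G : IntGroupoid C) : G.normalize.e ≫ G.comparison = G.e :=
  XMod.inl_q_desc _ _ _ _

theorem g_comparison (G : IntGroupoid C) : G.normalize.g ≫ G.comparison = kernel.ι G.c :=
  XMod.g_desc _ _ _ _

theorem comparison_d (G : IntGroupoid C) : G.comparison ≫ G.d = G.normalize.d := by
  apply XMod.sd_hom_ext
  · change G.normalize.e ≫ _ = G.normalize.e ≫ _
    rw [reassoc_of% G.e_comparison, G.e_d, XMod.e_d]
  · rw [reassoc_of% G.g_comparison, XMod.g_d]

theorem comparison_c (G : IntGroupoid C) : G.comparison ≫ G.c = G.normalize.c := by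
  apply XMod.sd_hom_ext
  · change G.normalize.e ≫ _ = G.normalize.e ≫ _
    rw [reassoc_of% G.e_comparison, G.e_c, XMod.e_c]
  · rw [reassoc_of% G.g_comparison, XMod.g_c, kernel.condition]

theorem comparison_naturality {G H : IntGroupoid C} (P : G ⟶ H) :
    (normalizeMap P).p₁ ≫ H.comparison = G.comparison ≫ P.f₁ := by
  apply XMod.sd_hom_ext
  · change G.normalize.e ≫ _ = G.normalize.e ≫ _
    rw [reassoc_of% (normalizeMap P).e_p₁, e_comparison, reassoc_of% G.e_comparison, P.e_f₁]
  · rw [reassoc_of% (normalizeMap P).g_p₁, g_comparison, reassoc_of% G.g_comparison]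
    exact kernel.lift_ι _ _ _

variable [HasDenormalization C]

theorem cmp_comparison (G : IntGroupoid C) {T : C} (x y : T ⟶ G.normalize.sd)
    (h : x ≫ G.normalize.c = y ≫ G.normalize.d) :
    G.normalize.cmp x y h ≫ G.comparison = G.cmp (x ≫ G.comparison) (y ≫ G.comparison)
      (by simp [comparison_c, comparison_d, h]) :=
  ReflGraph.cmp_map (G := G.normalize.denormalize) (H := G) (𝟙 G.G₀) G.comparison
    (G.comparison_d.trans (Category.comp_id _).symm)
    (G.comparison_c.trans (Category.comp_id _).symm)
    (G.e_comparison.trans (Category.id_comp _).symm) x y h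

/-- The 2-cell of crossed modules of an internal natural transformation `α : H₀ ⟶ G₁`, obtained
by identifying `G₁` with the semi-direct product. -/
noncomputable def normalizeMap₂ {H G : IntGroupoid C} {P Q : H ⟶ G} (α : P ⟶ Q) :
    normalizeMap P ⟶ normalizeMap Q :=
  XMod.Hom₂.mk (P := normalizeMap P) (Q := normalizeMap Q) (α.app ≫ inv G.comparison)
    (by rw [← comparison_d, Category.assoc, IsIso.inv_hom_id_assoc]; exact α.app_d)
    (by rw [← comparison_c, Category.assoc, IsIso.inv_hom_id_assoc]; exact α.app_c)
    (by
      rw [← cancel_mono G.comparison]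
      refine Eq.trans ?_ (G.cmp_comparison _ _ _).symm
      have h := α.nat (kernel.ι H.c)
      rw [cmp_unit _ _ _ _ (by simp)] at h
      rw [Category.assoc, g_comparison]
      refine (kernel.lift_ι _ _ _).trans (h.trans (cmp_congr _ _ ?_ ?_))
      · simp
      · rw [Category.assoc, g_comparison]; exact (kernel.lift_ι _ _ _).symm)

theorem normalizeMap₂_app {H G : IntGroupoid C} {P Q : H ⟶ G} (α : P ⟶ Q) :
    (normalizeMap₂ α).app ≫ G.comparison = α.app := by
  change (α.app ≫ inv G.comparison) ≫ G.comparison = α.app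
  simp

theorem hom₂_ext_comparison {H : XMod C} {G : IntGroupoid C} {P Q : H ⟶ G.normalize}
    {α β : P ⟶ Q} (h : XMod.Hom₂.app α ≫ G.comparison = XMod.Hom₂.app β ≫ G.comparison) :
    α = β :=
  XMod.hom₂_ext ((cancel_mono _).1 h)

end

end IntGroupoid

open Bicategory in
/-- The normalization functor from internal groupoids to internal crossed modules, as a 2-functor. -/
noncomputable def normalization (C : Type u) [Category.{v} C] [HasZeroMorphisms C] [SemiAbelian C]
    [HasSemidirectProducts C] [HasDenormalization C] :
    StrictPseudofunctor (IntGroupoid C) (XMod C) :=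
  StrictPseudofunctor.mk''
    { obj := IntGroupoid.normalize
      map := IntGroupoid.normalizeMap
      map₂ := IntGroupoid.normalizeMap₂
      map₂_id := fun {H G} P => by
        apply IntGroupoid.hom₂_ext_comparison
        rw [IntGroupoid.normalizeMap₂_app, XMod.id_app, Category.assoc, IntGroupoid.e_comparison]
        rfl
      map₂_comp := fun {H G P Q R} α β => by
        apply IntGroupoid.hom₂_ext_comparison
        rw [IntGroupoid.normalizeMap₂_app, XMod.comp_app, IntGroupoid.cmp_comparison]
        exact (IntGroupoid.cmp_congr _ _ (IntGroupoid.normalizeMap₂_app α)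
          (IntGroupoid.normalizeMap₂_app β)).symm
      map_id := IntGroupoid.normalizeMap_id
      map_comp := IntGroupoid.normalizeMap_comp
      map₂_whisker_left := fun {H G K} P {Q R} α => by
        apply XMod.hom₂_ext
        rw [XMod.eqToHom_comp_app, XMod.comp_eqToHom_app]
        exact Category.assoc _ _ _
      map₂_whisker_right := fun {H G K P Q} α R => by
        apply IntGroupoid.hom₂_ext_comparison
        rw [XMod.eqToHom_comp_app, XMod.comp_eqToHom_app, IntGroupoid.normalizeMap₂_app]
        change α.app ≫ R.f₁ = ((α.app ≫ inv G.comparison) ≫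
          (IntGroupoid.normalizeMap R).p₁) ≫ K.comparison
        rw [Category.assoc, IntGroupoid.comparison_naturality]
        simp }

/-- A pseudofunctor is a biequivalence if it is an equivalence on hom-categories and surjective on
objects up to (internal) equivalence. -/
def IsBiequivalence {B D : Type*} [Bicategory B] [Bicategory D] (F : Pseudofunctor B D) : Prop :=
  (∀ a b : B, (F.mapFunctor a b).IsEquivalence) ∧ ∀ d : D, ∃ b : B, Nonempty (Bicategory.Equivalence (F.obj b) d)

attribute [local simp] prod.lift_fst prod.lift_snd prod.lift_fst_assoc prod.lift_snd_assoc

/-!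
The argument works with generalized elements, existence statements being understood locally, that is
after passing to a regular epimorphism. Protomodularity is used in the form that the kernel and the
section of a split epimorphism are jointly (extremally) epic: an equation or a membership in a subobject
may be checked on the section and on the kernel. In this way relations are difunctional
(`SemiAbelian.Related.difunctional`), so reflexive relations are equivalence relations and, by
exactness, reflexive graphs have well-behaved quotients (`SemiAbelian.exists_quotient`); moreover
regular epimorphisms are cokernels of their kernels (`SemiAbelian.exists_desc_of_kernel`).

The semi-direct product is the quotient of the reflexive graph `[inl, ι], 1 + ξ : B + B ♭ A ⇉ B + A`.
Restricted to kernels over `B` this graph is `μ, B ♭ ξ : B ♭ (B ♭ A) ⇉ B ♭ A`, whose edges `ξ`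
identifies; hence `g` is a kernel of `c`, and the split short five lemma shows that a groupoid is
recovered from its normalization.

The main point is that the reflexive graph of a crossed module is a groupoid. The Peiffer condition says
that the split extension `G ⨯ G ⇄ G` given by the diagonal maps to the semi-direct product, through a
division `(x, y) ↦ x y⁻¹` of arrows with codomain `0` (`XMod.div`). Since the graph is locally symmetric,
every arrow of domain `0` is locally of the form `z y⁻¹` with `z` in the kernel of `∂`. That kernel
is central in `G`, so `(x, z, y) ↦ (x + z) y⁻¹` descends to a cooperator of the kernels of `c` and of
`d` (`XMod.huqCommute_g_kernel_d`). By the condition "Huq implies Smith" the kernel pairs of `c` and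
`d` have a connector `x y⁻¹ z`, which is associative and yields the groupoid
(`ReflGraph.IsConnector.groupoidStructure`).

Full faithfulness of normalization, on morphisms and on 2-cells, is checked on the kernel of `c` and on
the identities. Finally, the composite of `g` and `g •` is the cooperator, and composing with `g •`
exchanges the two forms of the condition on 2-cells (`XMod.exists_hom₂_iff`).
-/

/-! ### Split epimorphisms in a protomodular category -/

namespace SemiAbelian

/-- Membership in a subobject may be tested on a cover. -/
theorem exists_lift_of_cover {C : Type u} [Category.{v} C] {A B T T' : C} (j : A ⟶ B) [Mono j] (t : T' ⟶ T) [IsRegularEpi t]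
    (x : T ⟶ B) (y : T' ⟶ A) (h : y ≫ j = t ≫ x) : ∃ z : T ⟶ A, z ≫ j = x := by
  have sq : CommSq y t j x := ⟨h⟩
  exact ⟨sq.lift, sq.fac_right⟩

variable {C : Type u} [Category.{v} C] [HasZeroMorphisms C] [SemiAbelian C]

/-- The kernel and the section of a split epimorphism are jointly extremally epic. Most of the
arguments below rest on this form of protomodularity. -/
theorem isIso_of_mono_of_factors {A B V : C} (p : A ⟶ B) (s : B ⟶ A) (hs : s ≫ p = 𝟙 B)
    (j : V ⟶ A) [Mono j] (k : kernel p ⟶ V) (hk : k ≫ j = kernel.ι p)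
    (t : B ⟶ V) (ht : t ≫ j = s) : IsIso j := by
  have hp : (j ≫ p) ≫ 𝟙 B = j ≫ p := by simp
  have hiso : IsIso (kernel.map (j ≫ p) p j (𝟙 B) hp) := by
    refine ⟨kernel.lift _ k (by rw [reassoc_of% hk, kernel.condition]), ?_, ?_⟩
    · rw [← cancel_mono (kernel.ι (j ≫ p)), ← cancel_mono j]
      simp [hk]
    · ext; simp [hk]
  exact splitShortFive (j ≫ p) t (by rw [reassoc_of% ht, hs]) p s hs j (𝟙 B) hp
    (by rw [ht, Category.id_comp]) inferInstance hiso

/-- The two axes of a product are jointly epic. -/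
theorem prod_hom_ext {X Y Z : C} {f f' : X ⨯ Y ⟶ Z}
    (h₁ : prod.lift (𝟙 X) (0 : X ⟶ Y) ≫ f = prod.lift (𝟙 X) (0 : X ⟶ Y) ≫ f')
    (h₂ : prod.lift (0 : Y ⟶ X) (𝟙 Y) ≫ f = prod.lift (0 : Y ⟶ X) (𝟙 Y) ≫ f') : f = f' := by
  refine hom_ext prod.snd (prod.lift (0 : Y ⟶ X) (𝟙 Y)) (by simp) ?_ h₂
  have hk : kernel.ι (prod.snd : X ⨯ Y ⟶ Y) =
      (kernel.ι prod.snd ≫ prod.fst) ≫ prod.lift (𝟙 X) (0 : X ⟶ Y) := by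
    ext <;> simp
  rw [hk, Category.assoc, h₁, ← Category.assoc]

/-- The diagonal and the first axis of `X ⨯ X` are jointly epic. -/
theorem prod_self_hom_ext {X Z : C} {f f' : X ⨯ X ⟶ Z}
    (h₁ : prod.lift (𝟙 _) (𝟙 _) ≫ f = prod.lift (𝟙 _) (𝟙 _) ≫ f')
    (h₂ : prod.lift (𝟙 X) (0 : X ⟶ X) ≫ f = prod.lift (𝟙 _) 0 ≫ f') : f = f' := by
  refine hom_ext prod.snd _ (by simp) ?_ h₁
  have hk : kernel.ι (prod.snd : X ⨯ X ⟶ X) =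
      (kernel.ι prod.snd ≫ prod.fst) ≫ prod.lift (𝟙 _) 0 := by
    ext <;> simp
  rw [hk, Category.assoc, h₂, ← Category.assoc]

/-! ### Local existence along regular epimorphisms -/

/-- A generalized element of the codomain of a regular epimorphism lifts after passing to a
cover. -/
theorem exists_cover {P Q T : C} (e : P ⟶ Q) [IsRegularEpi e] (x : T ⟶ Q) :
    ∃ (T' : C) (t : T' ⟶ T) (_ : IsRegularEpi t) (y : T' ⟶ P), y ≫ e = t ≫ x :=
  ⟨_, pullback.snd e x, inferInstance, pullback.fst e x, pullback.condition⟩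

theorem isRegularEpi_of_exists_cover {P Q : C} (e : P ⟶ Q)
    (h : ∃ (T : C) (t : T ⟶ Q) (_ : IsRegularEpi t) (y : T ⟶ P), y ≫ e = t) :
    IsRegularEpi e := by
  obtain ⟨T, t, _, y, rfl⟩ := h
  have : StrongEpi e := strongEpi_of_strongEpi y e
  infer_instance

/-- A regular epimorphism is the cokernel of its kernel. -/
theorem exists_desc_of_kernel {E Q Z : C} (f : E ⟶ Q) [IsRegularEpi f] (h : E ⟶ Z)
    (hh : ∀ {T : C} (x : T ⟶ E), x ≫ f = 0 → x ≫ h = 0) : ∃ k : Q ⟶ Z, f ≫ k = h := by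
  refine IsRegularEpi.exists_of_isKernelPair f (IsKernelPair.of_hasPullback f) h ?_
  refine hom_ext (pullback.snd f f) (pullback.lift (𝟙 _) (𝟙 _) rfl) (by simp) ?_ (by simp)
  have h0 : kernel.ι (pullback.snd f f) ≫ pullback.fst f f ≫ f = 0 := by
    rw [pullback.condition, kernel.condition_assoc, zero_comp]
  rw [kernel.condition_assoc, zero_comp, ← Category.assoc]
  exact hh _ (by rw [Category.assoc, h0])

/-! ### Relations are difunctional -/

/-- The generalized elements `x` and `y` are related by the span `(r₁, r₂)`. -/
def Related {R A B T : C} (r₁ : R ⟶ A) (r₂ : R ⟶ B) (x : T ⟶ A) (y : T ⟶ B) : Prop :=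
  ∃ t : T ⟶ R, t ≫ r₁ = x ∧ t ≫ r₂ = y

/-- Every relation in a protomodular category is difunctional: `x R b`, `a R b` and `a R y` imply
`x R y`. Over the object of triples `(x, b, a)` with `x R b` and `a R b`, the quadruples form a split
epimorphism whose section `y = b` and whose kernel `x = b = a = 0` satisfy the claim. -/
theorem Related.difunctional {R A B T : C} {r₁ : R ⟶ A} {r₂ : R ⟶ B} [JointlyMono₂ r₁ r₂]
    {x a : T ⟶ A} {b y : T ⟶ B} (hxb : Related r₁ r₂ x b) (hab : Related r₁ r₂ a b)
    (hay : Related r₁ r₂ a y) : Related r₁ r₂ x y := by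
  have : Mono (prod.lift r₁ r₂) := ⟨fun f g h => by
    refine JointlyMono₂.right_cancellation (p₁ := r₁) (p₂ := r₂) f g ?_ ?_
    · simpa using h =≫ prod.fst
    · simpa using h =≫ prod.snd⟩
  -- `pullback w r₁` is the object of quadruples, and the pullback of `(x, y)` along the relation is
  -- its subobject of those with `x R y`
  let w := pullback.snd r₂ r₂ ≫ r₁
  let f : pullback w r₁ ⟶ A ⨯ B :=
    prod.lift (pullback.fst w r₁ ≫ pullback.fst r₂ r₂ ≫ r₁) (pullback.snd w r₁ ≫ r₂)
  let s : pullback r₂ r₂ ⟶ pullback w r₁ := pullback.lift (𝟙 _) (pullback.snd r₂ r₂) (by simp [w])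
  have hs : s ≫ pullback.fst w r₁ = 𝟙 _ := by simp [s]
  have hiso : IsIso (pullback.fst f (prod.lift r₁ r₂)) := by
    refine isIso_of_mono_of_factors (pullback.fst w r₁) s hs _
      (pullback.lift (kernel.ι _) (kernel.ι (pullback.fst w r₁) ≫ pullback.snd w r₁) ?_)
      (pullback.lift_fst _ _ _) (pullback.lift s (pullback.fst r₂ r₂) ?_) (pullback.lift_fst _ _ _)
    · ext
      · simp [f, ← pullback.condition, w]
      · simp [f]
    · ext
      · simp [f, s]
      · simp [f, s, pullback.condition]
  obtain ⟨p, hp₁, hp₂⟩ := hxb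
  obtain ⟨q, hq₁, hq₂⟩ := hab
  obtain ⟨r, hr₁, hr₂⟩ := hay
  let z : T ⟶ pullback w r₁ :=
    pullback.lift (pullback.lift p q (hp₂.trans hq₂.symm)) r (by simp [w, hq₁, hr₁])
  have hz := (z ≫ inv (pullback.fst f (prod.lift r₁ r₂))) ≫=
    (pullback.condition (f := f) (g := prod.lift r₁ r₂)).symm
  rw [Category.assoc, Category.assoc, IsIso.inv_hom_id_assoc] at hz
  refine ⟨z ≫ inv (pullback.fst f (prod.lift r₁ r₂)) ≫ pullback.snd _ _, ?_, ?_⟩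
  · simpa [f, z, hp₁] using hz =≫ prod.fst
  · simpa [f, z, hr₂] using hz =≫ prod.snd

theorem Related.symm {R A T : C} {r₁ r₂ : R ⟶ A} (hR : ReflexiveRelation r₁ r₂) {x y : T ⟶ A}
    (h : Related r₁ r₂ x y) : Related r₁ r₂ y x :=
  have := hR.toJointlyMono₂
  .difunctional ⟨y ≫ hR.r, by simp, by simp⟩ h ⟨x ≫ hR.r, by simp, by simp⟩

theorem Related.trans {R A T : C} {r₁ r₂ : R ⟶ A} (hR : ReflexiveRelation r₁ r₂) {x y z : T ⟶ A}
    (hxy : Related r₁ r₂ x y) (hyz : Related r₁ r₂ y z) : Related r₁ r₂ x z :=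
  have := hR.toJointlyMono₂
  .difunctional hxy ⟨y ≫ hR.r, by simp, by simp⟩ hyz

/-- A semi-abelian category is a Mal'tsev category: reflexive relations are equivalence
relations. -/
theorem isEquivalenceRelation_of_reflexive {R A : C} {r₁ r₂ : R ⟶ A}
    (hR : ReflexiveRelation r₁ r₂) : IsEquivalenceRelation r₁ r₂ := by
  obtain ⟨s, hs₁, hs₂⟩ := Related.symm hR ⟨𝟙 R, Category.id_comp _, Category.id_comp _⟩
  obtain ⟨t, ht₁, ht₂⟩ := Related.trans hR (x := pullback.fst r₂ r₁ ≫ r₁)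
    ⟨pullback.fst r₂ r₁, rfl, rfl⟩ ⟨pullback.snd r₂ r₁, pullback.condition.symm, rfl⟩
  exact ⟨⟨{ hR with
    s := s
    symmetry₁ := hs₁
    symmetry₂ := hs₂
    c := pullback.cone r₂ r₁
    isLimit := pullback.isLimit r₂ r₁
    t := t
    transitivity₁ := ht₁
    transitivity₂ := ht₂ }⟩⟩

/-! ### Quotients of reflexive graphs -/

/-- The image of a graph `u, v : P ⇉ A`: a relation covered by `P`. -/
theorem exists_image_relation {P A : C} (u v : P ⟶ A) :
    ∃ (R : C) (e : P ⟶ R) (r₁ r₂ : R ⟶ A), IsRegularEpi e ∧ JointlyMono₂ r₁ r₂ ∧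
      e ≫ r₁ = u ∧ e ≫ r₂ = v := by
  let F := Regular.strongEpiMonoFactorisation (prod.lift u v)
  have hm : Mono F.m := F.m_mono
  refine ⟨F.I, F.e, F.m ≫ prod.fst, F.m ≫ prod.snd,
    inferInstanceAs (IsRegularEpi (Regular.strongEpiMonoFactorisation _).e), ⟨?_⟩, ?_, ?_⟩
  · intro Y f g h₁ h₂
    rw [← cancel_mono F.m]
    ext
    · simpa using h₁
    · simpa using h₂
  · simp
  · simp

/-- A reflexive graph is symmetric up to passing to a cover. -/
theorem exists_reverse {P A T : C} {u v : P ⟶ A} (s : A ⟶ P) (hu : s ≫ u = 𝟙 A)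
    (hv : s ≫ v = 𝟙 A) (x : T ⟶ P) :
    ∃ (T' : C) (t : T' ⟶ T) (_ : IsRegularEpi t) (y : T' ⟶ P),
      y ≫ u = t ≫ x ≫ v ∧ y ≫ v = t ≫ x ≫ u := by
  obtain ⟨R, e, r₁, r₂, _, hj, rfl, rfl⟩ := exists_image_relation u v
  let hR : ReflexiveRelation r₁ r₂ :=
    { hj with
      r := s ≫ e
      reflexivity₁ := by rw [Category.assoc, hu]
      reflexivity₂ := by rw [Category.assoc, hv] }
  obtain ⟨w, hw₁, hw₂⟩ := Related.symm hR (x := x ≫ e ≫ r₁) ⟨x ≫ e, by simp, rfl⟩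
  obtain ⟨T', t, ht, y, hy⟩ := exists_cover e w
  exact ⟨T', t, ht, y, by rw [reassoc_of% hy, hw₁]; simp, by rw [reassoc_of% hy, hw₂]⟩

/-- A reflexive graph `u, v : P ⇉ A` has a coequalizer `q`, and generalized elements of `A` with
the same image in the quotient are locally joined by an edge. -/
theorem exists_quotient {P A : C} {u v : P ⟶ A} (s : A ⟶ P) (hu : s ≫ u = 𝟙 A)
    (hv : s ≫ v = 𝟙 A) :
    ∃ (Q : C) (q : A ⟶ Q), Epi q ∧ u ≫ q = v ≫ q ∧
      (∀ {Z : C} (f : A ⟶ Z), u ≫ f = v ≫ f → ∃ k : Q ⟶ Z, q ≫ k = f) ∧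
      ∀ {T : C} (x y : T ⟶ A), x ≫ q = y ≫ q →
        ∃ (T' : C) (t : T' ⟶ T) (_ : IsRegularEpi t) (w : T' ⟶ P),
          w ≫ u = t ≫ x ∧ w ≫ v = t ≫ y := by
  obtain ⟨R, e, r₁, r₂, _, hj, rfl, rfl⟩ := exists_image_relation u v
  let hR : ReflexiveRelation r₁ r₂ :=
    { hj with
      r := s ≫ e
      reflexivity₁ := by rw [Category.assoc, hu]
      reflexivity₂ := by rw [Category.assoc, hv] }
  obtain ⟨B, q, hq⟩ := effective r₁ r₂ (isEquivalenceRelation_of_reflexive hR)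
  have : HasCoequalizer r₁ r₂ := Regular.hasCoequalizer_of_isKernelPair hq
  refine ⟨coequalizer r₁ r₂, coequalizer.π r₁ r₂, inferInstance, ?_, ?_, ?_⟩
  · rw [Category.assoc, Category.assoc, coequalizer.condition]
  · intro Z f hf
    rw [Category.assoc, Category.assoc, cancel_epi] at hf
    exact ⟨coequalizer.desc f hf, coequalizer.π_desc _ _⟩
  · intro T x y h
    have hxy : x ≫ q = y ≫ q := by
      have := h =≫ coequalizer.desc q hq.w
      simpa using this
    obtain ⟨T', t, ht, w, hw⟩ := exists_cover e (hq.lift x y hxy)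
    exact ⟨T', t, ht, w, by simp [reassoc_of% hw], by simp [reassoc_of% hw]⟩

end SemiAbelian

/-! ### Semi-direct products -/

section Semidirect

variable {C : Type u} [Category.{v} C] [HasZeroMorphisms C] [SemiAbelian C]

/-- A split extension is the semi-direct product of its kernel action: arrows out of the base and
out of the kernel which are compatible with the action extend to the middle object. -/
theorem SemiAbelian.exists_splitExtension_desc {A B E Z : C} (p : E ⟶ B) (s : B ⟶ E)
    (hs : s ≫ p = 𝟙 B) (k : A ⟶ E) [Mono k] (hkp : k ≫ p = 0)
    (hk : ∃ l : kernel p ⟶ A, l ≫ k = kernel.ι p) (ξ : flat B A ⟶ A)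
    (hξ : ξ ≫ k = flatι B A ≫ coprod.desc s k) (a : B ⟶ Z) (b : A ⟶ Z)
    (hab : flatι B A ≫ coprod.desc a b = ξ ≫ b) : ∃ f : E ⟶ Z, s ≫ f = a ∧ k ≫ f = b := by
  have : IsRegularEpi (coprod.desc s k) := by
    let F := Regular.strongEpiMonoFactorisation (coprod.desc s k)
    have : Mono F.m := F.m_mono
    obtain ⟨l, hl⟩ := hk
    have hF : F.e ≫ F.m = coprod.desc s k := F.fac
    have : IsIso F.m := isIso_of_mono_of_factors p s hs F.m (l ≫ coprod.inr ≫ F.e)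
      (by simp [hF, hl]) (coprod.inl ≫ F.e) (by simp [hF])
    have : IsRegularEpi F.e :=
      inferInstanceAs (IsRegularEpi (Regular.strongEpiMonoFactorisation _).e)
    exact isRegularEpi_of_exists_cover _ ⟨_, F.e ≫ F.m, by
      have : StrongEpi (F.e ≫ F.m) := strongEpi_comp _ _
      infer_instance, 𝟙 _, by rw [hF, Category.id_comp]⟩
  -- an element of the kernel of `[s, k]` is an element `y` of `B ♭ A` with `ξ y = 0`
  obtain ⟨f, hf⟩ := exists_desc_of_kernel (coprod.desc s k) (coprod.desc a b) fun x hx => by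
    have h0 : x ≫ coprod.desc (𝟙 B) 0 = 0 := by
      have : coprod.desc (𝟙 B) 0 = coprod.desc s k ≫ p := by ext <;> simp [hs, hkp]
      rw [this, reassoc_of% hx, zero_comp]
    have hy := flatLift_ι x h0
    have h1 : flatLift x h0 ≫ ξ = 0 := by
      rw [← cancel_mono k, Category.assoc, hξ, reassoc_of% hy, hx, zero_comp]
    rw [← hy, Category.assoc, hab, reassoc_of% h1, zero_comp]
  exact ⟨f, by simpa using coprod.inl ≫= hf, by simpa using coprod.inr ≫= hf⟩

/-- The coequalizer of `[inl, ι]` and `1 + ξ`, from `B + B ♭ A` to `B + A`, is the semi-direct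
product. The point of this presentation is that the graph is reflexive. -/
theorem exists_semidirectProduct {B : C} {A : (flatMonad B).Algebra} {a : flat B A.A ⟶ A.A}
    (ha : a = A.a) :
    ∃ (Q : C) (q : B ⨿ A.A ⟶ Q), Epi q ∧ flatι B A.A ≫ q = (a ≫ coprod.inr) ≫ q ∧
      (∀ {Z : C} (f : B ⨿ A.A ⟶ Z), flatι B A.A ≫ f = (a ≫ coprod.inr) ≫ f →
        ∃ k : Q ⟶ Z, q ≫ k = f) ∧
      ∀ {T : C} (x y : T ⟶ B ⨿ A.A), x ≫ q = y ≫ q →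
        ∃ (T' : C) (t : T' ⟶ T) (_ : IsRegularEpi t) (w : T' ⟶ B ⨿ flat B A.A),
          w ≫ coprod.desc coprod.inl (flatι B A.A) = t ≫ x ∧
          w ≫ coprod.map (𝟙 B) a = t ≫ y := by
  have hunit : flatUnit B A.A ≫ a = 𝟙 _ := by subst ha; exact A.unit
  have key {Z : C} (f : B ⨿ A.A ⟶ Z) :
      coprod.desc coprod.inl (flatι B A.A) ≫ f = coprod.map (𝟙 B) a ≫ f ↔
        flatι B A.A ≫ f = (a ≫ coprod.inr) ≫ f := by
    refine ⟨fun h => by simpa using coprod.inr ≫= h, fun h => ?_⟩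
    apply coprod.hom_ext
    · simp
    · simpa using h
  obtain ⟨Q, q, hq, w, hdesc, hcov⟩ := SemiAbelian.exists_quotient
    (u := coprod.desc coprod.inl (flatι B A.A)) (v := coprod.map (𝟙 B) a)
    (coprod.map (𝟙 B) (flatUnit B A.A))
    (by ext <;> simp [flatUnit_ι]) (by ext <;> simp [reassoc_of% hunit])
  exact ⟨Q, q, hq, (key q).1 w, fun f hf => hdesc f ((key f).2 hf), hcov⟩

theorem hasSemidirectProducts_of_semiAbelian : HasSemidirectProducts C where
  hasCoequalizer B A := by
    obtain ⟨Q, q, _, w, hdesc, -⟩ := exists_semidirectProduct (B := B) (A := A) rfl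
    choose k hk using @hdesc
    exact ⟨⟨⟨Cofork.ofπ q w, Cofork.IsColimit.mk _ (fun c => k c.π c.condition)
      (fun c => hk c.π c.condition)
      (fun c m hm => (cancel_epi q).1 (hm.trans (hk c.π c.condition).symm))⟩⟩⟩

namespace XMod

variable (X : XMod C)

theorem flatUnit_ξ : flatUnit X.base X.top ≫ X.ξ = 𝟙 _ := X.act.unit

theorem flatMul_ξ : flatMul X.base X.top ≫ X.ξ = flatMap (𝟙 _) X.ξ ≫ X.ξ := X.act.assoc

variable [HasSemidirectProducts C]

instance : IsRegularEpi X.q := inferInstanceAs (IsRegularEpi (coequalizer.π _ _))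

/-- Elements of `G₀ + G` with the same image in the semi-direct product are locally related by the
reflexive graph presenting it. -/
theorem exists_cover_of_q_eq {T : C} (x y : T ⟶ X.base ⨿ X.top) (h : x ≫ X.q = y ≫ X.q) :
    ∃ (T' : C) (t : T' ⟶ T) (_ : IsRegularEpi t) (w : T' ⟶ X.base ⨿ flat X.base X.top),
      w ≫ coprod.desc coprod.inl (flatι X.base X.top) = t ≫ x ∧
      w ≫ coprod.map (𝟙 X.base) X.ξ = t ≫ y := by
  obtain ⟨Q, q, -, w, -, hcov⟩ :=
    exists_semidirectProduct (B := X.base) (A := X.act) (a := X.ξ) rfl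
  obtain ⟨k, hk⟩ : ∃ k : X.sd ⟶ Q, X.q ≫ k = q := ⟨coequalizer.desc q w, coequalizer.π_desc _ _⟩
  exact hcov x y (by rw [← hk, reassoc_of% h])

/-- The morphism `g` is monic: the kernel of `G₀ + G₀ ♭ G ⟶ G₀` is the free action on `G₀ ♭ G`, on which the two edges
of the graph presenting the semi-direct product are identified by the algebra axiom. -/
instance : Mono X.g := ⟨fun {T} x y h => by
  obtain ⟨T', t, _, w, hw₁, hw₂⟩ := X.exists_cover_of_q_eq (x ≫ coprod.inr) (y ≫ coprod.inr)
    (by simpa [g] using h)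
  have h0 : w ≫ coprod.desc (𝟙 X.base) 0 = 0 := by
    have : (coprod.desc (𝟙 X.base) 0 : X.base ⨿ flat X.base X.top ⟶ _) =
        coprod.map (𝟙 X.base) X.ξ ≫ coprod.desc (𝟙 X.base) 0 := by ext <;> simp
    rw [this, reassoc_of% hw₂]; simp
  have hz := flatLift_ι w h0
  set z := flatLift w h0
  have h₁ : z ≫ flatMul _ _ = t ≫ x ≫ flatUnit _ _ := by
    rw [← cancel_mono (flatι _ _), Category.assoc, flatMul_ι, reassoc_of% hz, hw₁]
    simp [flatUnit_ι]
  have h₂ : z ≫ flatMap (𝟙 _) X.ξ = t ≫ y ≫ flatUnit _ _ := by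
    rw [← cancel_mono (flatι _ _), Category.assoc, flatMap_ι, reassoc_of% hz, hw₂]
    simp [flatUnit_ι]
  have h₃ := h₁ =≫ X.ξ
  rw [Category.assoc, flatMul_ξ, reassoc_of% h₂] at h₃
  rw [← cancel_epi t]
  simpa [flatUnit_ξ] using h₃.symm⟩

/-- `g` is a kernel of `c`. -/
theorem exists_lift_g {T : C} (x : T ⟶ X.sd) (h : x ≫ X.c = 0) : ∃ y : T ⟶ X.top, y ≫ X.g = x := by
  -- locally `x` comes from an element `z` of `G₀ ♭ G`, and then `ξ z` is the required lift
  obtain ⟨T', t, _, y, hy⟩ := SemiAbelian.exists_cover X.q x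
  have hc : X.q ≫ X.c = coprod.desc (𝟙 _) 0 := X.q_desc _ _ _
  have h0 : y ≫ coprod.desc (𝟙 _) 0 = 0 := by
    rw [← hc, reassoc_of% hy, h, comp_zero]
  refine SemiAbelian.exists_lift_of_cover X.g t x (flatLift y h0 ≫ X.ξ) ?_
  rw [← hy, Category.assoc, g, ← ι_q, ← Category.assoc, flatLift_ι]

/-- The factorization of an arrow killed by `c` through `g`. -/
noncomputable def liftG {T : C} (x : T ⟶ X.sd) (h : x ≫ X.c = 0) : T ⟶ X.top :=
  (X.exists_lift_g x h).choose

theorem liftG_g {T : C} (x : T ⟶ X.sd) (h : x ≫ X.c = 0) : X.liftG x h ≫ X.g = x :=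
  (X.exists_lift_g x h).choose_spec

end XMod

/-- The semi-direct product recovers the object of arrows of a groupoid, by the split short five
lemma. -/
theorem IntGroupoid.isIso_comparison [HasSemidirectProducts C] (G : IntGroupoid C) :
    IsIso G.comparison := by
  have hp : G.normalize.c ≫ 𝟙 _ = G.comparison ≫ G.c := by
    rw [comparison_c, Category.comp_id]
  refine SemiAbelian.splitShortFive G.normalize.c G.normalize.e G.normalize.e_c G.c G.e G.e_c
    G.comparison (𝟙 _) hp (by rw [e_comparison, Category.id_comp]) inferInstance ?_
  refine ⟨kernel.lift _ G.normalize.g G.normalize.g_c, ?_, ?_⟩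
  · obtain ⟨y, hy⟩ := G.normalize.exists_lift_g (kernel.ι G.normalize.c) (kernel.condition _)
    have h : kernel.map G.normalize.c G.c G.comparison (𝟙 _) hp = y := by
      rw [← cancel_mono (kernel.ι G.c), kernel.lift_ι, ← hy, Category.assoc, g_comparison]
    rw [h, ← cancel_mono (kernel.ι _), Category.assoc, kernel.lift_ι, hy, Category.id_comp]
  · rw [← cancel_mono (kernel.ι G.c), Category.assoc, kernel.lift_ι, kernel.lift_ι_assoc,
      g_comparison, Category.id_comp]

end Semidirect

/-! ### The Peiffer condition and the commutation of the kernels -/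

theorem HuqCommute.precomp {C : Type u} [Category.{v} C] [HasZeroMorphisms C] [HasFiniteLimits C]
    {X Y X' Y' E : C} {f : X ⟶ E} {g : Y ⟶ E} (h : HuqCommute f g) (x : X' ⟶ X) (y : Y' ⟶ Y) :
    HuqCommute (x ≫ f) (y ≫ g) := by
  obtain ⟨φ, h₁, h₂⟩ := h
  refine ⟨prod.map x y ≫ φ, ?_, ?_⟩
  · have : prod.lift (𝟙 X') (0 : X' ⟶ Y') ≫ prod.map x y = x ≫ prod.lift (𝟙 X) 0 := by
      ext <;> simp
    rw [reassoc_of% this, h₁]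
  · have : prod.lift (0 : Y' ⟶ X') (𝟙 Y') ≫ prod.map x y = y ≫ prod.lift 0 (𝟙 Y) := by
      ext <;> simp
    rw [reassoc_of% this, h₂]

namespace XMod

variable {C : Type u} [Category.{v} C] [HasZeroMorphisms C] [SemiAbelian C]
  [HasSemidirectProducts C] (X : XMod C)

/-- The split extension `G ⟶ G ⨯ G ⇄ G` with the diagonal as section has the conjugation action as
its kernel action, so by the Peiffer condition `g` and `∂ ≫ e` extend to `G ⨯ G`. -/
theorem exists_div : ∃ κ : X.top ⨯ X.top ⟶ X.sd,
    prod.lift (𝟙 _) (𝟙 _) ≫ κ = X.bd ≫ X.e ∧ prod.lift (𝟙 _) 0 ≫ κ = X.g := by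
  have : IsSplitMono (prod.lift (𝟙 X.top) (0 : X.top ⟶ X.top)) := ⟨⟨⟨prod.fst, by simp⟩⟩⟩
  refine SemiAbelian.exists_splitExtension_desc prod.snd _ (by simp) _ (by simp)
    ⟨kernel.ι prod.snd ≫ prod.fst, by ext <;> simp⟩ (conj X.top) ?_ _ _ ?_
  · have h : coprod.desc (prod.lift (𝟙 X.top) (𝟙 X.top)) (prod.lift (𝟙 X.top) 0) =
        prod.lift (coprod.desc (𝟙 _) (𝟙 _)) (coprod.desc (𝟙 _) 0) := by
      ext <;> simp
    rw [h, conj]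
    ext
    · simp
    · simp [flatι_desc]
  · have h : coprod.desc (X.bd ≫ X.e) X.g = coprod.map X.bd (𝟙 _) ≫ X.q := by
      ext <;> simp [g, e]
    have hp : flatMap X.bd (𝟙 X.top) ≫ X.ξ = conj X.top := X.peiffer
    rw [h, ← flatMap_ι_assoc, ι_q, reassoc_of% hp, g]

/-- The division `(x, y) ↦ x y⁻¹` of arrows with codomain `0`, where `x` and `y` stand for `g x` and
`g y`; it has domain `∂ x` and codomain `∂ y`. -/
noncomputable def div : X.top ⨯ X.top ⟶ X.sd := X.exists_div.choose

theorem diag_div : prod.lift (𝟙 _) (𝟙 _) ≫ X.div = X.bd ≫ X.e := X.exists_div.choose_spec.1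

theorem inl_div : prod.lift (𝟙 _) 0 ≫ X.div = X.g := X.exists_div.choose_spec.2

theorem lift_self_div {T : C} (x : T ⟶ X.top) : prod.lift x x ≫ X.div = x ≫ X.bd ≫ X.e := by
  rw [← diag_div, ← Category.assoc]; congr 1; ext <;> simp

theorem lift_zero_div {T : C} (x : T ⟶ X.top) : prod.lift x 0 ≫ X.div = x ≫ X.g := by
  rw [← inl_div, ← Category.assoc]; congr 1; ext <;> simp

theorem div_c : X.div ≫ X.c = prod.snd ≫ X.bd := by
  apply SemiAbelian.prod_self_hom_ext
  · rw [reassoc_of% X.diag_div, e_c]; simp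
  · rw [reassoc_of% X.inl_div, g_c]; simp

theorem div_d : X.div ≫ X.d = prod.fst ≫ X.bd := by
  apply SemiAbelian.prod_self_hom_ext
  · rw [reassoc_of% X.diag_div, e_d]; simp
  · rw [reassoc_of% X.inl_div, g_d]; simp

/-- Division identifies `G ⨯ G` with the object of pairs `(n, y)` with `c n = ∂ y`. -/
instance isIso_lift_div :
    IsIso (pullback.lift X.div prod.snd X.div_c : X.top ⨯ X.top ⟶ pullback X.c X.bd) := by
  have hp : (prod.snd : X.top ⨯ X.top ⟶ X.top) ≫ 𝟙 _ =
      pullback.lift X.div prod.snd X.div_c ≫ pullback.snd X.c X.bd := by simp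
  refine SemiAbelian.splitShortFive prod.snd (prod.lift (𝟙 _) (𝟙 _)) (by simp)
    (pullback.snd X.c X.bd) (pullback.lift (X.bd ≫ X.e) (𝟙 _) (by simp [e_c])) (by simp)
    _ (𝟙 _) hp ?_ inferInstance ?_
  · ext <;> simp [diag_div]
  · have h0 : (kernel.ι (pullback.snd X.c X.bd) ≫ pullback.fst X.c X.bd) ≫ X.c = 0 := by
      rw [Category.assoc, pullback.condition, kernel.condition_assoc, zero_comp]
    refine ⟨kernel.lift _ (prod.lift (X.liftG _ h0) 0) (by simp), ?_, ?_⟩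
    · have hk : kernel.ι (prod.snd : X.top ⨯ X.top ⟶ X.top) ≫ X.div =
          (kernel.ι prod.snd ≫ prod.fst) ≫ X.g := by
        rw [← lift_zero_div]; congr 1; ext <;> simp
      rw [← cancel_mono (kernel.ι _), Category.assoc, kernel.lift_ι, Category.id_comp]
      ext
      · rw [← cancel_mono X.g]
        simp [liftG_g, hk]
      · simp
    · rw [← cancel_mono (kernel.ι _), Category.assoc, kernel.lift_ι, kernel.lift_ι_assoc,
        Category.id_comp]
      ext
      · simp [lift_zero_div, liftG_g]
      · simp

/-- An arrow `n` can be composed with an arrow `y` of codomain `0`. -/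
theorem exists_lift_div {T : C} (n : T ⟶ X.sd) (y : T ⟶ X.top) (h : n ≫ X.c = y ≫ X.bd) :
    ∃ x : T ⟶ X.top, prod.lift x y ≫ X.div = n := by
  let f : X.top ⨯ X.top ⟶ pullback X.c X.bd := pullback.lift X.div prod.snd X.div_c
  have hf₁ : inv f ≫ X.div = pullback.fst X.c X.bd := by
    rw [IsIso.inv_comp_eq]; simp [f]
  have hf₂ : inv f ≫ prod.snd = pullback.snd X.c X.bd := by
    rw [IsIso.inv_comp_eq]; simp [f]
  refine ⟨pullback.lift n y h ≫ inv f ≫ prod.fst, ?_⟩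
  have : prod.lift (pullback.lift n y h ≫ inv f ≫ prod.fst) y = pullback.lift n y h ≫ inv f := by
    ext
    · simp
    · simp [hf₂]
  rw [this, Category.assoc, hf₁, pullback.lift_fst]

theorem lift_div_cancel {T : C} {x x' y : T ⟶ X.top}
    (h : prod.lift x y ≫ X.div = prod.lift x' y ≫ X.div) : x = x' := by
  have := (cancel_mono (pullback.lift X.div prod.snd X.div_c)).1
    (show prod.lift x y ≫ pullback.lift X.div prod.snd X.div_c =
      prod.lift x' y ≫ pullback.lift X.div prod.snd X.div_c by ext <;> simp [h])
  simpa using this =≫ prod.fst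

/-- The kernel of `∂` is central in `G`. The product of `x` and `w` is the solution `s` of
`s w⁻¹ = x`. -/
theorem huqCommute_id_kernel_bd : HuqCommute (𝟙 X.top) (kernel.ι X.bd) := by
  obtain ⟨s, hs⟩ := X.exists_lift_div (T := X.top ⨯ kernel X.bd) (prod.fst ≫ X.g)
    (prod.snd ≫ kernel.ι X.bd) (by simp [g_c])
  refine ⟨s, X.lift_div_cancel (y := 0) ?_, X.lift_div_cancel (y := kernel.ι X.bd) ?_⟩
  · have := prod.lift (𝟙 X.top) (0 : X.top ⟶ kernel X.bd) ≫= hs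
    rw [← Category.assoc, prod.comp_lift] at this
    rw [inl_div]
    simpa using this
  · have := prod.lift (0 : kernel X.bd ⟶ X.top) (𝟙 (kernel X.bd)) ≫= hs
    rw [← Category.assoc, prod.comp_lift] at this
    rw [lift_self_div, kernel.condition_assoc, zero_comp]
    simpa using this

/-- The arrows of domain `0` are locally of the form `z y⁻¹` with `∂ z = 0`. -/
theorem exists_cover_of_comp_d_eq_zero {T : C} (n : T ⟶ X.sd) (h : n ≫ X.d = 0) :
    ∃ (T' : C) (t : T' ⟶ T) (_ : IsRegularEpi t) (z : T' ⟶ kernel X.bd) (y : T' ⟶ X.top),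
      prod.lift (z ≫ kernel.ι X.bd) y ≫ X.div = t ≫ n := by
  -- an arrow `y` in the opposite direction, hence of codomain `0`; then `n` is `(n y) y⁻¹`
  obtain ⟨T', t, ht, n', h₁, h₂⟩ := SemiAbelian.exists_reverse X.e X.e_d X.e_c n
  rw [h, comp_zero] at h₂
  have hy : X.liftG n' h₂ ≫ X.bd = t ≫ n ≫ X.c := by
    rw [← h₁, ← X.g_d, ← Category.assoc, liftG_g]
  obtain ⟨x, hx⟩ := X.exists_lift_div (t ≫ n) (X.liftG n' h₂) (by rw [Category.assoc, hy])
  have hx0 : x ≫ X.bd = 0 := by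
    have := hx =≫ X.d
    rw [Category.assoc, div_d, Category.assoc, h, comp_zero] at this
    simpa using this
  exact ⟨T', t, ht, kernel.lift _ x hx0, X.liftG n' h₂, by rw [kernel.lift_ι, hx]⟩

/-- The kernels of `c` and of `d` commute. On the cover `(z, y) ↦ z y⁻¹` of the kernel of `d`, a
cooperator is given by `(x, (z, y)) ↦ (x + z) y⁻¹`. -/
theorem huqCommute_g_kernel_d : HuqCommute X.g (kernel.ι X.d) := by
  obtain ⟨s, hs₁, hs₂⟩ := X.huqCommute_id_kernel_bd
  -- the cover `ν (z, y) = z y⁻¹` of the kernel of `d`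
  let ν : kernel X.bd ⨯ X.top ⟶ kernel X.d :=
    kernel.lift X.d (prod.lift (prod.fst ≫ kernel.ι X.bd) prod.snd ≫ X.div)
      (by rw [Category.assoc, div_d]; simp)
  have hν : ν ≫ kernel.ι X.d = prod.lift (prod.fst ≫ kernel.ι X.bd) prod.snd ≫ X.div :=
    kernel.lift_ι _ _ _
  have : IsRegularEpi ν := by
    refine SemiAbelian.isRegularEpi_of_exists_cover _ ?_
    obtain ⟨T, t, ht, z, y, h⟩ := X.exists_cover_of_comp_d_eq_zero (kernel.ι X.d) (by simp)
    refine ⟨T, t, ht, prod.lift z y, ?_⟩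
    rw [← cancel_mono (kernel.ι X.d), ← h, Category.assoc, hν, ← Category.assoc,
      prod.comp_lift]
    simp
  have : IsRegularEpi (prod.map (𝟙 X.top) ν) := by
    refine SemiAbelian.isRegularEpi_of_exists_cover _ ?_
    obtain ⟨T, t, ht, y, h⟩ := SemiAbelian.exists_cover ν (prod.snd : X.top ⨯ kernel X.d ⟶ _)
    refine ⟨T, t, ht, prod.lift (t ≫ prod.fst) y, ?_⟩
    ext <;> simp [h]
  -- `φ (x, (z, y)) = (x + z) y⁻¹`, where `s` is the sum
  let φ : X.top ⨯ (kernel X.bd ⨯ X.top) ⟶ X.sd :=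
    prod.lift (prod.lift prod.fst (prod.snd ≫ prod.fst) ≫ s) (prod.snd ≫ prod.snd) ≫ X.div
  have hφ₂ {T : C} (w : T ⟶ kernel X.bd ⨯ X.top) :
      prod.lift 0 w ≫ φ = w ≫ ν ≫ kernel.ι X.d := by
    have h : prod.lift 0 (w ≫ prod.fst) ≫ s = w ≫ prod.fst ≫ kernel.ι X.bd := by
      rw [← hs₂, ← Category.assoc, ← Category.assoc]; congr 1; ext <;> simp
    rw [hν, ← Category.assoc, ← Category.assoc]
    congr 1
    ext
    · simp [← Category.assoc, prod.comp_lift, ← h]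
    · simp
  have hφ₁ : prod.lift (𝟙 X.top) (0 : X.top ⟶ kernel X.bd ⨯ X.top) ≫ φ = X.g := by
    rw [← inl_div, ← Category.assoc]
    congr 1
    ext
    · simpa [← Category.assoc, prod.comp_lift] using hs₁
    · simp
  -- `φ` descends along `1 × ν`, since on the kernel `x = 0`, `ν (z, y) = 0` it equals `ν (z, y)`
  obtain ⟨ψ, hψ⟩ := SemiAbelian.exists_desc_of_kernel (prod.map (𝟙 X.top) ν) φ fun x hx => by
    have h₁ : x ≫ prod.fst = 0 := by simpa using hx =≫ prod.fst
    have h₂ : x ≫ prod.snd ≫ ν = 0 := by simpa using hx =≫ prod.snd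
    have hx' : x = prod.lift 0 (x ≫ prod.snd) := by ext <;> simp [h₁]
    rw [hx', hφ₂, Category.assoc, reassoc_of% h₂, zero_comp]
  refine ⟨ψ, ?_, ?_⟩
  · rw [← hφ₁, ← hψ, ← Category.assoc]; congr 1; ext <;> simp
  · rw [← cancel_epi ν, ← Category.id_comp (ν ≫ kernel.ι X.d), ← hφ₂, ← hψ, ← Category.assoc,
      ← Category.assoc]
    congr 1
    ext <;> simp

end XMod

/-! ### From a connector to a groupoid -/

namespace ReflGraph

variable {C : Type u} [Category.{v} C] [HasZeroMorphisms C] [SemiAbelian C] (Γ : ReflGraph C)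

/-- The object of triples `(x, y, z)` of arrows with `c x = c y` and `d y = d z`. -/
noncomputable abbrev triples : C := pullback (pullback.snd Γ.c Γ.c) (pullback.fst Γ.d Γ.d)

variable {Γ}

/-- The triple of three generalized elements. -/
noncomputable def triple {T : C} (x y z : T ⟶ Γ.G₁) (hxy : x ≫ Γ.c = y ≫ Γ.c)
    (hyz : y ≫ Γ.d = z ≫ Γ.d) : T ⟶ Γ.triples :=
  pullback.lift (pullback.lift x y hxy) (pullback.lift y z hyz) (by simp)

theorem comp_triple {S T : C} (t : S ⟶ T) (x y z : T ⟶ Γ.G₁) (hxy : x ≫ Γ.c = y ≫ Γ.c)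
    (hyz : y ≫ Γ.d = z ≫ Γ.d) :
    t ≫ triple x y z hxy hyz =
      triple (t ≫ x) (t ≫ y) (t ≫ z) (by simp [hxy]) (by simp [hyz]) := by
  unfold triple
  ext <;> simp

/-- A connector `Φ` between the kernel pairs of `c` and of `d`: in elements `Φ (x, y, y) = x` and
`Φ (y, y, z) = z`, so that `Φ (x, y, z)` stands for `x y⁻¹ z`. -/
structure IsConnector (Φ : Γ.triples ⟶ Γ.G₁) : Prop where
  right {T : C} (x y : T ⟶ Γ.G₁) (h : x ≫ Γ.c = y ≫ Γ.c) : triple x y y h rfl ≫ Φ = x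
  left {T : C} (y z : T ⟶ Γ.G₁) (h : y ≫ Γ.d = z ≫ Γ.d) : triple y y z rfl h ≫ Φ = z

theorem exists_isConnector {hR : EquivalenceRelation (pullback.fst Γ.c Γ.c) (pullback.snd Γ.c Γ.c)}
    {hS : EquivalenceRelation (pullback.fst Γ.d Γ.d) (pullback.snd Γ.d Γ.d)}
    (h : SmithCommute hR hS) : ∃ Φ : Γ.triples ⟶ Γ.G₁, IsConnector Φ := by
  obtain ⟨Φ, h₁, h₂⟩ := h
  refine ⟨Φ, fun {T} x y h => ?_, fun {T} y z h => ?_⟩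
  · have : triple x y y h rfl = pullback.lift x y h ≫
        pullback.lift (𝟙 _) (pullback.snd Γ.c Γ.c ≫ hS.r) (by simp) := by
      unfold triple
      ext <;> simp
    rw [this, Category.assoc, h₁, pullback.lift_fst]
  · have : triple y y z rfl h = pullback.lift y z h ≫
        pullback.lift (pullback.fst Γ.d Γ.d ≫ hR.r) (𝟙 _) (by simp) := by
      unfold triple
      ext <;> simp
    rw [this, Category.assoc, h₂, pullback.lift_snd]

namespace IsConnector

variable {Φ : Γ.triples ⟶ Γ.G₁}

/-- The domain and codomain of `Φ (x, y, z)`. It suffices to know them at `(x, y, y)` and at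
`(0, 0, z)`, where the value of `Φ` is prescribed. -/
theorem comp_d_c (hΦ : IsConnector Φ) :
    Φ ≫ Γ.d = pullback.fst _ _ ≫ pullback.fst _ _ ≫ Γ.d ∧
      Φ ≫ Γ.c = pullback.snd _ _ ≫ pullback.snd _ _ ≫ Γ.c := by
  let p : Γ.triples ⟶ pullback Γ.c Γ.c := pullback.fst _ _
  let s : pullback Γ.c Γ.c ⟶ Γ.triples := triple (pullback.fst Γ.c Γ.c) (pullback.snd Γ.c Γ.c)
    (pullback.snd Γ.c Γ.c) pullback.condition rfl
  have hs : s ≫ p = 𝟙 _ := by ext <;> simp [s, p, triple]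
  have hsΦ : s ≫ Φ = pullback.fst _ _ := hΦ.right _ _ _
  have h0 : kernel.ι p ≫ pullback.fst _ _ = 0 := kernel.condition p
  have h0' : kernel.ι p ≫ pullback.snd _ _ ≫ pullback.fst _ _ = 0 := by
    rw [← pullback.condition, reassoc_of% h0, zero_comp]
  have hk : kernel.ι p = triple 0 0 (kernel.ι p ≫ pullback.snd _ _ ≫ pullback.snd _ _) rfl
      (by rw [Category.assoc, Category.assoc, ← pullback.condition, reassoc_of% h0']) := by
    unfold triple
    ext
    · simp [reassoc_of% h0]
    · simp [reassoc_of% h0]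
    · simp [h0']
    · simp
  have hkΦ : kernel.ι p ≫ Φ = kernel.ι p ≫ pullback.snd _ _ ≫ pullback.snd _ _ := by
    conv_lhs => rw [hk]
    exact hΦ.left _ _ _
  constructor
  · refine SemiAbelian.hom_ext p s hs ?_ ?_
    · rw [reassoc_of% hkΦ, ← pullback.condition, reassoc_of% h0', reassoc_of% h0]; simp
    · rw [reassoc_of% hsΦ]; simp [s, triple]
  · refine SemiAbelian.hom_ext p s hs ?_ ?_
    · rw [reassoc_of% hkΦ]
    · rw [reassoc_of% hsΦ, pullback.condition]; simp [s, triple]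

theorem triple_d (hΦ : IsConnector Φ) {T : C} (x y z : T ⟶ Γ.G₁) (hxy : x ≫ Γ.c = y ≫ Γ.c)
    (hyz : y ≫ Γ.d = z ≫ Γ.d) : (triple x y z hxy hyz ≫ Φ) ≫ Γ.d = x ≫ Γ.d := by
  rw [Category.assoc, hΦ.comp_d_c.1]
  simp [triple]

theorem triple_c (hΦ : IsConnector Φ) {T : C} (x y z : T ⟶ Γ.G₁) (hxy : x ≫ Γ.c = y ≫ Γ.c)
    (hyz : y ≫ Γ.d = z ≫ Γ.d) : (triple x y z hxy hyz ≫ Φ) ≫ Γ.c = z ≫ Γ.c := by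
  rw [Category.assoc, hΦ.comp_d_c.2]
  simp [triple]

theorem triple_congr {T : C} {x x' y y' z z' : T ⟶ Γ.G₁} (hxy : x ≫ Γ.c = y ≫ Γ.c)
    (hyz : y ≫ Γ.d = z ≫ Γ.d) (hx : x = x') (hy : y = y') (hz : z = z') :
    triple x y z hxy hyz =
      triple x' y' z' (by rw [← hx, ← hy, hxy]) (by rw [← hy, ← hz, hyz]) := by
  subst hx hy hz; rfl

/-- Connectors are associative. Over the object of triples `(x, y, u)`, the quintuples
`(x, y, u, v, z)` form a split epimorphism, with section `v = z = u`; both sides agree on this section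
and where `x = y = u = 0`. -/
theorem assoc (hΦ : IsConnector Φ) {T : C} (x y u v z : T ⟶ Γ.G₁) (hxy : x ≫ Γ.c = y ≫ Γ.c)
    (hyu : y ≫ Γ.d = u ≫ Γ.d) (huv : u ≫ Γ.c = v ≫ Γ.c) (hvz : v ≫ Γ.d = z ≫ Γ.d) :
    triple (triple x y u hxy hyu ≫ Φ) v z ((hΦ.triple_c x y u hxy hyu).trans huv) hvz ≫ Φ =
      triple x y (triple u v z huv hvz ≫ Φ) hxy
        (hyu.trans (hΦ.triple_d u v z huv hvz).symm) ≫ Φ := by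
  -- quintuples are pairs of triples in which the last entry of one is the first of the other
  let r : Γ.triples ⟶ Γ.G₁ := pullback.snd _ _ ≫ pullback.snd _ _
  let l : Γ.triples ⟶ Γ.G₁ := pullback.fst _ _ ≫ pullback.fst _ _
  let p := pullback.fst r l
  let x' : pullback r l ⟶ Γ.G₁ := p ≫ pullback.fst _ _ ≫ pullback.fst _ _
  let y' : pullback r l ⟶ Γ.G₁ := p ≫ pullback.fst _ _ ≫ pullback.snd _ _
  let u' : pullback r l ⟶ Γ.G₁ := p ≫ r
  let v' : pullback r l ⟶ Γ.G₁ := pullback.snd r l ≫ pullback.snd _ _ ≫ pullback.fst _ _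
  let z' : pullback r l ⟶ Γ.G₁ := pullback.snd r l ≫ pullback.snd _ _ ≫ pullback.snd _ _
  have hrl : p ≫ r = pullback.snd r l ≫ l := pullback.condition
  have hxy' : x' ≫ Γ.c = y' ≫ Γ.c := by
    simp only [x', y', Category.assoc, pullback.condition (f := Γ.c) (g := Γ.c)]
  have hyu' : y' ≫ Γ.d = u' ≫ Γ.d := by
    simp only [y', u', r, Category.assoc, ← pullback.condition (f := Γ.d) (g := Γ.d),
      ← pullback.condition_assoc]
  have huv' : u' ≫ Γ.c = v' ≫ Γ.c := by
    simp only [u', v', hrl, l, Category.assoc, pullback.condition (f := Γ.c) (g := Γ.c)]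
    rw [pullback.condition_assoc]
  have hvz' : v' ≫ Γ.d = z' ≫ Γ.d := by simp [v', z', pullback.condition]
  have key : triple (triple x' y' u' hxy' hyu' ≫ Φ) v' z'
      ((hΦ.triple_c x' y' u' hxy' hyu').trans huv') hvz' ≫ Φ =
      triple x' y' (triple u' v' z' huv' hvz' ≫ Φ) hxy'
        (hyu'.trans (hΦ.triple_d u' v' z' huv' hvz').symm) ≫ Φ := by
    -- the section `v = z = u`
    let s : Γ.triples ⟶ pullback r l := pullback.lift (𝟙 _) (triple r r r rfl rfl)
      (by simp [triple, l])
    refine SemiAbelian.hom_ext p s (by simp [s, p]) ?_ ?_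
    · have hp : kernel.ι p ≫ p = 0 := kernel.condition p
      have hx : kernel.ι p ≫ x' = 0 := by simp only [x', reassoc_of% hp, zero_comp]
      have hy : kernel.ι p ≫ y' = 0 := by simp only [y', reassoc_of% hp, zero_comp]
      have e₁ : kernel.ι p ≫ triple x' y' u' hxy' hyu' ≫ Φ = kernel.ι p ≫ u' := by
        rw [← Category.assoc, comp_triple, triple_congr _ _ (hx.trans hy.symm) rfl rfl]
        exact hΦ.left _ _ _
      have e₂ : triple (kernel.ι p ≫ u') (kernel.ι p ≫ v') (kernel.ι p ≫ z')
          (by simp [huv']) (by simp [hvz']) = kernel.ι p ≫ triple u' v' z' huv' hvz' :=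
        (comp_triple _ _ _ _ _ _).symm
      rw [← Category.assoc, ← Category.assoc, comp_triple, comp_triple,
        triple_congr _ _ e₁ rfl rfl, triple_congr _ _ (hx.trans hy.symm) rfl rfl, hΦ.left, e₂,
        Category.assoc]
    · have hu : s ≫ u' = r := by simp [s, u', p]
      have hv : s ≫ v' = r := by simp [s, v', triple]
      have hz : s ≫ z' = r := by simp [s, z', triple]
      have e₁ : s ≫ triple u' v' z' huv' hvz' ≫ Φ = s ≫ u' := by
        rw [← Category.assoc, comp_triple, triple_congr _ _ rfl (hv.trans hu.symm)
          (hz.trans hu.symm)]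
        exact hΦ.right _ _ _
      rw [← Category.assoc, ← Category.assoc, comp_triple, comp_triple,
        triple_congr _ _ rfl rfl (hz.trans hv.symm), triple_congr _ _ rfl rfl e₁, hΦ.right,
        ← Category.assoc, comp_triple]
  let t : T ⟶ pullback r l := pullback.lift (triple x y u hxy hyu) (triple u v z huv hvz)
    (by simp [triple, r, l])
  have hx : t ≫ x' = x := by simp [t, x', p, triple]
  have hy : t ≫ y' = y := by simp [t, y', p, triple]
  have hu : t ≫ u' = u := by simp [t, u', p, r, triple]
  have hv : t ≫ v' = v := by simp [t, v', triple]
  have hz : t ≫ z' = z := by simp [t, z', triple]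
  have := t ≫= key
  rw [← Category.assoc, ← Category.assoc, comp_triple, comp_triple] at this
  refine Eq.trans ?_ (this.trans ?_)
  · rw [triple_congr _ _ _ hv hz]
    rw [← Category.assoc, comp_triple, triple_congr _ _ hx hy hu]
  · rw [triple_congr _ _ hx hy _]
    rw [← Category.assoc, comp_triple, triple_congr _ _ hu hv hz]

/-- The composition defined by a connector: the composite of `x` and `z` is `x 1⁻¹ z`. -/
noncomputable def mul (Φ : Γ.triples ⟶ Γ.G₁) : pullback Γ.c Γ.d ⟶ Γ.G₁ :=
  triple (pullback.fst Γ.c Γ.d) (pullback.fst Γ.c Γ.d ≫ Γ.c ≫ Γ.e) (pullback.snd Γ.c Γ.d)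
    (by simp [Γ.e_c]) (by simp [Γ.e_d, pullback.condition]) ≫ Φ

theorem lift_mul {T : C} (x z : T ⟶ Γ.G₁) (h : x ≫ Γ.c = z ≫ Γ.d) :
    pullback.lift x z h ≫ mul Φ =
      triple x (x ≫ Γ.c ≫ Γ.e) z (by simp [Γ.e_c]) (by simp [Γ.e_d, h]) ≫ Φ := by
  rw [mul, ← Category.assoc, comp_triple]
  congr 1
  apply triple_congr <;> simp

/-- The groupoid of a connector; the inverse of `x` is `1 x⁻¹ 1`. -/
noncomputable def groupoidStructure (hΦ : IsConnector Φ) : GroupoidStructure Γ where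
  m := mul Φ
  m_d := hΦ.triple_d _ _ _ _ _
  m_c := hΦ.triple_c _ _ _ _ _
  e_m := by
    rw [lift_mul, triple_congr _ _ rfl (y' := Γ.d ≫ Γ.e) (by simp [reassoc_of% Γ.e_c]) rfl]
    exact hΦ.left _ _ _
  m_e := by
    rw [lift_mul, triple_congr _ _ rfl (y' := Γ.c ≫ Γ.e) (by simp) rfl]
    exact hΦ.right _ _ _
  assoc x y z hxy hyz := by
    have hc : (pullback.lift x y hxy ≫ mul Φ) ≫ Γ.c = y ≫ Γ.c := by
      rw [lift_mul, hΦ.triple_c]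
    refine (lift_mul _ _ _).trans (Eq.trans ?_ (lift_mul _ _ _).symm)
    rw [triple_congr _ _ (lift_mul x y hxy) (by rw [← Category.assoc, hc, Category.assoc]) rfl,
      triple_congr _ _ rfl rfl (lift_mul y z hyz)]
    exact hΦ.assoc _ _ _ _ _ _ _ _ _
  i := triple (Γ.c ≫ Γ.e) (𝟙 _) (Γ.d ≫ Γ.e) (by simp [Γ.e_c]) (by simp [Γ.e_d]) ≫ Φ
  i_d := by rw [hΦ.triple_d]; simp [Γ.e_d]
  i_c := by rw [hΦ.triple_c]; simp [Γ.e_c]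
  m_i := by
    -- `x 1⁻¹ (1 x⁻¹ 1) = (x 1⁻¹ 1) x⁻¹ 1 = x x⁻¹ 1 = 1`
    rw [lift_mul, triple_congr _ _ rfl (Category.id_comp _) rfl, ← hΦ.assoc _ _ _ _ _
      (by simp [Γ.e_c]) rfl (by simp [Γ.e_c]) (by simp [Γ.e_d]),
      triple_congr _ _ (hΦ.right _ _ _) rfl rfl]
    exact hΦ.left _ _ _
  i_m := by
    have hc : (triple (Γ.c ≫ Γ.e) (𝟙 _) (Γ.d ≫ Γ.e) (by simp [Γ.e_c]) (by simp [Γ.e_d]) ≫ Φ) ≫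
        Γ.c ≫ Γ.e = Γ.d ≫ Γ.e := by
      rw [← Category.assoc, hΦ.triple_c]; simp [reassoc_of% Γ.e_c]
    -- `(1 x⁻¹ 1) 1⁻¹ x = 1 x⁻¹ (1 1⁻¹ x) = 1 x⁻¹ x = 1`
    rw [lift_mul, triple_congr _ _ rfl hc rfl, hΦ.assoc _ _ _ _ _ _ _ rfl (by simp [Γ.e_d]),
      triple_congr _ _ rfl rfl (hΦ.left _ _ _)]
    exact hΦ.right _ _ _

end IsConnector

/-- If "Huq implies Smith" holds, a reflexive graph in which the kernels of `c` and of `d` commute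
is a groupoid. -/
theorem nonempty_groupoidStructure [HuqImpliesSmith C]
    (h : HuqCommute (kernel.ι Γ.c) (kernel.ι Γ.d)) : Nonempty (GroupoidStructure Γ) := by
  let hR : EquivalenceRelation (pullback.fst Γ.c Γ.c) (pullback.snd Γ.c Γ.c) :=
    (IsKernelPair.of_hasPullback Γ.c).equivalenceRelation _ _ _ (pullback.isLimit _ _)
  let hS : EquivalenceRelation (pullback.fst Γ.d Γ.d) (pullback.snd Γ.d Γ.d) :=
    (IsKernelPair.of_hasPullback Γ.d).equivalenceRelation _ _ _ (pullback.isLimit _ _)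
  have hc : (kernel.ι (pullback.snd Γ.c Γ.c) ≫ pullback.fst Γ.c Γ.c) ≫ Γ.c = 0 := by
    rw [Category.assoc, pullback.condition, kernel.condition_assoc, zero_comp]
  have hd : (kernel.ι (pullback.snd Γ.d Γ.d) ≫ pullback.fst Γ.d Γ.d) ≫ Γ.d = 0 := by
    rw [Category.assoc, pullback.condition, kernel.condition_assoc, zero_comp]
  have hRS : SmithCommute hR hS := HuqImpliesSmith.smithCommute hR hS (by
    have := h.precomp (kernel.lift _ _ hc) (kernel.lift _ _ hd)
    rwa [kernel.lift_ι, kernel.lift_ι] at this)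
  obtain ⟨Φ, hΦ⟩ := exists_isConnector hRS
  exact ⟨hΦ.groupoidStructure⟩

end ReflGraph

/-- Crossed modules denormalize to groupoids: the Peiffer condition makes the kernels of `c` and of `d`
commute. -/
theorem hasDenormalization_of_huqImpliesSmith {C : Type u} [Category.{v} C] [HasZeroMorphisms C]
    [SemiAbelian C] [HuqImpliesSmith C] [HasSemidirectProducts C] : HasDenormalization C where
  groupoid X := by
    refine ReflGraph.nonempty_groupoidStructure ?_
    have := X.huqCommute_g_kernel_d.precomp (X.liftG (kernel.ι X.c) (kernel.condition _)) (𝟙 _)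
    rwa [X.liftG_g, Category.id_comp] at this
  comparison G := G.isIso_comparison

/-! ### Normalization is an equivalence -/

section Normalization

variable {C : Type u} [Category.{v} C] [HasZeroMorphisms C] [SemiAbelian C]

/-- Normalization is faithful: a functor is determined by its restrictions to the kernel of `c` and to
the identities. -/
theorem IntGroupoid.normalizeMap_injective {H G : IntGroupoid C} {P Q : H ⟶ G}
    (h : normalizeMap P = normalizeMap Q) : P = Q := by
  have h₀ : P.f₀ = Q.f₀ := congrArg XMod.Hom.p₀ h
  refine Hom.ext h₀ (SemiAbelian.hom_ext H.c H.e H.e_c ?_ (by rw [P.e_f₁, Q.e_f₁, h₀]))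
  rw [← normalizeMap_p_ι, ← normalizeMap_p_ι, h]

variable [HasSemidirectProducts C]

namespace XMod

variable (X : XMod C)

theorem flatι_desc_eq_ξ_g {A : C} (f : A ⟶ X.top) :
    flatι X.base A ≫ coprod.desc X.e (f ≫ X.g) = flatMap (𝟙 _) f ≫ X.ξ ≫ X.g := by
  have h : coprod.desc X.e (f ≫ X.g) = coprod.map (𝟙 _) f ≫ X.q := by
    ext <;> simp [g, e]
  rw [h, ← flatMap_ι_assoc, ι_q, g]

variable [HasDenormalization C]

/-- The kernel of `c : G ⋊ G₀ ⟶ G₀` is `G`, as a crossed module. -/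
noncomputable def normalizeDenormalizeHom : X.denormalize.normalize ⟶ X :=
  Hom.mk (X := X.denormalize.normalize) (Y := X)
    (X.liftG (kernel.ι X.c) (kernel.condition _)) (𝟙 _)
    (by
      change flatMap (𝟙 _) _ ≫ X.ξ = X.denormalize.normAct ≫ _
      rw [← cancel_mono X.g, Category.assoc, Category.assoc, liftG_g, ← flatι_desc_eq_ξ_g,
        liftG_g, X.denormalize.normAct_ι])
    (by
      change (kernel.ι X.c ≫ X.d) ≫ 𝟙 _ = _
      rw [Category.comp_id, ← X.g_d, ← Category.assoc, liftG_g])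

/-- The inverse of `normalizeDenormalizeHom`. -/
noncomputable def normalizeDenormalizeInv : X ⟶ X.denormalize.normalize :=
  Hom.mk (X := X) (Y := X.denormalize.normalize)
    (kernel.lift X.c X.g X.g_c) (𝟙 _)
    (by
      change flatMap (𝟙 _) _ ≫ X.denormalize.normAct = X.ξ ≫ _
      have hg : kernel.lift X.c X.g X.g_c ≫ kernel.ι X.c = X.g := kernel.lift_ι _ _ _
      have hq : coprod.map (𝟙 X.base) (kernel.lift X.c X.g X.g_c) ≫
          coprod.desc X.e (kernel.ι X.c) = X.q := by
        ext <;> simp [g, e]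
      rw [← cancel_mono (kernel.ι X.c), Category.assoc, Category.assoc, hg,
        X.denormalize.normAct_ι, flatMap_ι_assoc, hq, ι_q, g])
    (by
      change X.bd ≫ 𝟙 _ = kernel.lift X.c X.g X.g_c ≫ kernel.ι X.c ≫ X.d
      rw [Category.comp_id, kernel.lift_ι_assoc, g_d])

theorem normalizeDenormalize_hom_inv :
    X.normalizeDenormalizeHom ≫ X.normalizeDenormalizeInv = 𝟙 _ := by
  apply Hom.ext
  · change X.liftG (kernel.ι X.c) (kernel.condition _) ≫ kernel.lift X.c X.g X.g_c = 𝟙 _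
    rw [← cancel_mono (kernel.ι X.c), Category.assoc, kernel.lift_ι, liftG_g, Category.id_comp]
  · exact Category.comp_id _

theorem normalizeDenormalize_inv_hom :
    X.normalizeDenormalizeInv ≫ X.normalizeDenormalizeHom = 𝟙 _ := by
  apply Hom.ext
  · change kernel.lift X.c X.g X.g_c ≫ X.liftG (kernel.ι X.c) (kernel.condition _) = 𝟙 _
    rw [← cancel_mono X.g, Category.assoc, liftG_g, kernel.lift_ι, Category.id_comp]
  · exact Category.comp_id _

end XMod

namespace IntGroupoid

variable [HasDenormalization C]

/-- A morphism between normalizations comes from a functor: on arrows it is the morphism induced on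
semi-direct products, and it preserves composition since every morphism of reflexive graphs does. -/
theorem exists_normalizeMap_eq {H G : IntGroupoid C} (Q : H.normalize ⟶ G.normalize) :
    ∃ P : H ⟶ G, normalizeMap P = Q := by
  let f₁ : H.G₁ ⟶ G.G₁ := inv H.comparison ≫ Q.p₁ ≫ G.comparison
  have hf : H.comparison ≫ f₁ = Q.p₁ ≫ G.comparison := by simp [f₁]
  have hd : f₁ ≫ G.d = H.d ≫ Q.p₀ := by
    rw [← cancel_epi H.comparison, reassoc_of% hf, comparison_d, Q.p₁_d, ← comparison_d,
      Category.assoc]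
  have hc : f₁ ≫ G.c = H.c ≫ Q.p₀ := by
    rw [← cancel_epi H.comparison, reassoc_of% hf, comparison_c, Q.p₁_c, ← comparison_c,
      Category.assoc]
  have he : H.e ≫ f₁ = Q.p₀ ≫ G.e := by
    rw [← e_comparison, Category.assoc, hf, reassoc_of% Q.e_p₁, e_comparison]
  let P : Hom H G :=
    { f₀ := Q.p₀
      f₁ := f₁
      f₁_d := hd
      f₁_c := hc
      e_f₁ := he
      m_f₁ := by
        have h := ReflGraph.cmp_map Q.p₀ f₁ hd hc he (pullback.fst H.c H.d) (pullback.snd H.c H.d)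
          pullback.condition
        have h1 : pullback.lift (pullback.fst H.c H.d) (pullback.snd H.c H.d)
          pullback.condition = 𝟙 _ := by ext <;> simp
        rwa [cmp, h1, Category.id_comp] at h }
  refine ⟨P, XMod.Hom.ext ?_ rfl⟩
  rw [← cancel_mono (kernel.ι G.c), normalizeMap_p_ι, ← g_comparison, ← g_comparison,
    Category.assoc]
  change H.normalize.g ≫ H.comparison ≫ f₁ = _
  rw [hf, reassoc_of% Q.g_p₁]

theorem normalizeMap₂_injective {H G : IntGroupoid C} {P Q : H ⟶ G} {α β : P ⟶ Q}
    (h : normalizeMap₂ α = normalizeMap₂ β) : α = β := by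
  apply hom₂_ext
  rw [← normalizeMap₂_app, ← normalizeMap₂_app, h]

theorem exists_normalizeMap₂_eq {H G : IntGroupoid C} {P Q : H ⟶ G}
    (β : normalizeMap P ⟶ normalizeMap Q) : ∃ α : P ⟶ Q, normalizeMap₂ α = β := by
  have hd : (XMod.Hom₂.app β ≫ G.comparison) ≫ G.d = P.f₀ := by
    rw [Category.assoc, comparison_d]; exact β.app_d
  have hc : (XMod.Hom₂.app β ≫ G.comparison) ≫ G.c = Q.f₀ := by
    rw [Category.assoc, comparison_c]; exact β.app_c
  let α : Hom₂ P Q :=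
    { app := XMod.Hom₂.app β ≫ G.comparison
      app_d := hd
      app_c := hc
      naturality := by
        have h := XMod.Hom₂.naturality β =≫ G.comparison
        rw [cmp_comparison, cmp_comparison] at h
        rw [← cancel_epi H.comparison, comp_cmp, comp_cmp]
        refine Eq.trans (cmp_congr _ _ ?_ ?_) (h.trans (cmp_congr _ _ ?_ ?_))
        · exact (comparison_naturality P).symm
        · rw [reassoc_of% H.comparison_c, Category.assoc]
        · rw [reassoc_of% H.comparison_d, Category.assoc]
        · exact comparison_naturality Q }
  exact ⟨α, hom₂_ext_comparison (normalizeMap₂_app (P := P) (Q := Q) α)⟩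

end IntGroupoid

variable [HasDenormalization C]

theorem isEquivalence_normalization : (normalization C).toFunctor.IsEquivalence where
  faithful := ⟨fun h => IntGroupoid.normalizeMap_injective h⟩
  full := ⟨fun Q => IntGroupoid.exists_normalizeMap_eq Q⟩
  essSurj := ⟨fun X => ⟨X.denormalize, ⟨⟨X.normalizeDenormalizeHom, X.normalizeDenormalizeInv,
    X.normalizeDenormalize_hom_inv, X.normalizeDenormalize_inv_hom⟩⟩⟩⟩

theorem isBiequivalence_normalization : IsBiequivalence (normalization C).toPseudofunctor := by
  refine ⟨fun H G => ?_, fun X => ⟨X.denormalize, ⟨?_⟩⟩⟩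
  · exact
      { faithful := ⟨fun h => IntGroupoid.normalizeMap₂_injective h⟩
        full := ⟨fun β => IntGroupoid.exists_normalizeMap₂_eq β⟩
        essSurj := ⟨fun Q => by
          obtain ⟨P, hP⟩ := IntGroupoid.exists_normalizeMap_eq Q
          exact ⟨P, ⟨eqToIso hP⟩⟩⟩ }
  · exact Bicategory.Equivalence.mkOfAdjointifyCounit
      (f := X.normalizeDenormalizeHom) (g := X.normalizeDenormalizeInv)
      (XMod.isoOfEq X.normalizeDenormalize_hom_inv.symm)
      (XMod.isoOfEq X.normalizeDenormalize_inv_hom)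

end Normalization

/-! ### Two-cells and the cooperator -/

namespace XMod

variable {C : Type u} [Category.{v} C] [HasZeroMorphisms C] [SemiAbelian C]
  [HasSemidirectProducts C] [HasDenormalization C] (X : XMod C)

theorem gInv_d : X.gInv ≫ X.d = 0 := by
  have h := X.denormalize.str.i_d
  rw [gInv, Category.assoc]
  exact (X.g ≫= h).trans X.g_c

theorem gInv_c : X.gInv ≫ X.c = X.bd := by
  have h := X.denormalize.str.i_c
  rw [gInv, Category.assoc]
  exact (X.g ≫= h).trans X.g_d

theorem cmp_g_gInv {T : C} (q : T ⟶ X.top) :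
    X.cmp (q ≫ X.g) (q ≫ X.gInv) (by simp [g_c, gInv_d]) = q ≫ X.bd ≫ X.e := by
  have h := (q ≫ X.g) ≫= X.denormalize.str.m_i
  have h' := X.comp_cmp (q ≫ X.g) (𝟙 _) X.denormalize.str.i
    (by rw [Category.id_comp]; exact X.denormalize.str.i_d.symm)
  refine Eq.trans ?_ (h'.symm.trans (h.trans ?_))
  · apply cmp_congr <;> simp [gInv]
  · change (q ≫ X.g) ≫ X.d ≫ X.e = _
    rw [Category.assoc, reassoc_of% X.g_d]

theorem cmp_gInv_g {T : C} (q : T ⟶ X.top) :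
    X.cmp (q ≫ X.gInv) (q ≫ X.g) (by simp [g_d, gInv_c]) = 0 := by
  have h := (q ≫ X.g) ≫= X.denormalize.str.i_m
  have h' := X.comp_cmp (q ≫ X.g) X.denormalize.str.i (𝟙 _)
    (by rw [Category.id_comp]; exact X.denormalize.str.i_c)
  refine Eq.trans ?_ (h'.symm.trans (h.trans ?_))
  · apply cmp_congr <;> simp [gInv]
  · change (q ≫ X.g) ≫ X.c ≫ X.e = _
    rw [Category.assoc, reassoc_of% X.g_c, zero_comp, comp_zero]

/-- The composite of `g` and `g •` is their cooperator. -/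
theorem isCooperator_cmp : IsCooperator X.g X.gInv
    (X.cmp (prod.fst ≫ X.g) (prod.snd ≫ X.gInv) (by simp [g_c, gInv_d])) := by
  constructor
  · rw [comp_cmp, cmp_unit _ _ _ _ (by simp)]
    simp
  · rw [comp_cmp, unit_cmp _ _ _ _ (by simp)]
    simp

theorem lift_cooperator {φ : X.top ⨯ X.top ⟶ X.sd} (hφ : IsCooperator X.g X.gInv φ) {T : C}
    (x y : T ⟶ X.top) :
    prod.lift x y ≫ φ = X.cmp (x ≫ X.g) (y ≫ X.gInv) (by simp [g_c, gInv_d]) := by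
  have h := X.isCooperator_cmp
  rw [SemiAbelian.prod_hom_ext (hφ.1.trans h.1.symm) (hφ.2.trans h.2.symm), comp_cmp]
  apply cmp_congr <;> simp

/-- Composition with `g •` on the right inverts composition with `g` on the right, which turns the
equation `p ≫ g = ⟨∂ ≫ α, q ≫ g⟩ ≫ m` of a 2-cell into `∂ ≫ α = ⟨p, q⟩ ≫ φ`. -/
theorem exists_hom₂_iff {Y : XMod C} (P Q : Hom Y X) {φ : X.top ⨯ X.top ⟶ X.sd}
    (hφ : IsCooperator X.g X.gInv φ) (α : Y.base ⟶ X.sd) (hd : α ≫ X.d = P.p₀)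
    (hc : α ≫ X.c = Q.p₀) :
    (∃ β : Hom₂ P Q, β.app = α) ↔ Y.bd ≫ α = prod.lift P.p Q.p ≫ φ := by
  have hαq : (Y.bd ≫ α) ≫ X.c = (Q.p ≫ X.g) ≫ X.d := by
    rw [Category.assoc, Category.assoc, hc, g_d, Q.bd_p]
  have hpq : (P.p ≫ X.g) ≫ X.c = (Q.p ≫ X.gInv) ≫ X.d := by simp [g_c, gInv_d]
  have hqq : (Q.p ≫ X.g) ≫ X.c = (Q.p ≫ X.gInv) ≫ X.d := by simp [g_c, gInv_d]
  have hqq' : (Q.p ≫ X.gInv) ≫ X.c = (Q.p ≫ X.g) ≫ X.d := by simp [g_d, gInv_c]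
  rw [X.lift_cooperator hφ]
  constructor
  · rintro ⟨β, rfl⟩
    rw [X.cmp_congr _ β.star' rfl, X.cmp_assoc _ _ _ hαq hqq, X.cmp_congr _ rfl (X.cmp_g_gInv _),
      X.cmp_unit _ _ _ (by simp [e_d_assoc])]
  · intro h
    refine ⟨⟨α, hd, hc, ?_⟩, rfl⟩
    change P.p ≫ X.g = X.cmp (Y.bd ≫ α) (Q.p ≫ X.g) hαq
    rw [X.cmp_congr _ h rfl, X.cmp_assoc _ _ _ hpq hqq', X.cmp_congr _ rfl (X.cmp_gInv_g _),
      X.cmp_unit _ _ _ (by simp)]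

end XMod

/-- In a semi-abelian category in which the condition "Huq implies Smith" holds, the semi-direct
products and the denormalizations of crossed modules exist, so that crossed modules form a
2-category, and
* normalization is an equivalence of categories from internal groupoids to crossed modules,
* its extension to natural transformations is a biequivalence of 2-categories, and
* the 2-cells of crossed modules are characterized by the cooperator of `g` and `g •`. -/
theorem mainTheorem6 {C : Type u} [Category.{v} C] [HasZeroMorphisms C] [SemiAbelian C]
    [HuqImpliesSmith C] :
    ∃ (_ : HasSemidirectProducts C) (_ : HasDenormalization C),
      (normalization C).toFunctor.IsEquivalence ∧
      IsBiequivalence (normalization C).toPseudofunctor ∧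
      (∀ G : XMod C, ∃! φ : G.top ⨯ G.top ⟶ G.sd, IsCooperator G.g G.gInv φ) ∧
      ∀ (H G : XMod C) (P Q : XMod.Hom H G) (φ : G.top ⨯ G.top ⟶ G.sd),
        IsCooperator G.g G.gInv φ →
        ∀ (α : H.base ⟶ G.sd), α ≫ G.d = P.p₀ → α ≫ G.c = Q.p₀ →
          ((∃ β : XMod.Hom₂ P Q, β.app = α) ↔ H.bd ≫ α = prod.lift P.p Q.p ≫ φ) := by
  have h₁ : HasSemidirectProducts C := hasSemidirectProducts_of_semiAbelian
  have h₂ : HasDenormalization C := hasDenormalization_of_huqImpliesSmith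
  refine ⟨h₁, h₂, isEquivalence_normalization, isBiequivalence_normalization, fun G => ?_,
    fun H G P Q φ hφ α hd hc => G.exists_hom₂_iff P Q hφ α hd hc⟩
  exact ⟨_, G.isCooperator_cmp, fun ψ hψ => SemiAbelian.prod_hom_ext
    (hψ.1.trans G.isCooperator_cmp.1.symm) (hψ.2.trans G.isCooperator_cmp.2.symm)⟩
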